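/- Let $k$ be a field, $\mathcal C$ a small $k$-linear category and $M$ a nonzero right $\mathcal C$-module, i.e. a nonzero $k$-linear functor from $\mathcal C^{op}$ to $k$-vector spaces, $x\mapsto M_x$. The one-point extension $\mathcal C[M]$ is the $k$-linear category whose objects are those of $\mathcal C$ and one new object $*$, with $\mathrm{Hom}(x,y)=\mathrm{Hom}_{\mathcal C}(x,y)$, $\mathrm{Hom}(x,*)=M_x$, $\mathrm{Hom}(*,x)=0$ and $\mathrm{Hom}(*,*)=k$ for objects $x,y$ of $\mathcal C$; composition is given by composition in $\mathcal C$, the action of $\mathcal C$ on $M$ and the multiplication by scalars. For a $k$-linear category $\mathcal D$ let $HH^n(\mathcal D)$ be its Hochschild-Mitchell cohomology with coefficients in the bimodule $\mathcal D$, i.e. the cohomology of the complex with terms $$\prod_{(x_0,\dots,x_n)}\mathrm{Hom}_k\big(\mathrm{Hom}_{\mathcal D}(x_{0},x_1)\otimes\cdots\otimes \mathrm{Hom}_{\mathcal D}(x_{n-1},x_n),\ \mathrm{Hom}_{\mathcal D}(x_0,x_n)\big)$$ (the product being over all $(n+1)$-tuples of objects of $\mathcal D$) and the usual Hochschild differential.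 Let $\mathrm{Ext}^n_{\mathcal C}$ denote the Ext spaces in the abelian category of right $\mathcal C$-modules, and let $\mathrm{Hom}_{\mathcal C}(M,M)/k$ be the quotient by the scalar multiples of the identity. Then there is a long exact sequence of $k$-vector spaces $$0 \to HH^{0}(\mathcal C[M]) \to HH^{0}(\mathcal C) \to \mathrm{Hom}_{\mathcal C}(M,M)/k \to HH^{1}(\mathcal C[M]) \to HH^{1}(\mathcal C) \to \mathrm{Ext}^{1}_{\mathcal C}(M,M) \to \cdots$$ $$\cdots \to \mathrm{Ext}^{n-1}_{\mathcal C}(M,M) \to HH^{n}(\mathcal C[M]) \to HH^{n}(\mathcal C) \to \mathrm{Ext}^{n}_{\mathcal C}(M,M) \to HH^{n+1}(\mathcal C[M]) \to \cdots$$ in which the maps $HH^{n}(\mathcal C[M]) \to HH^{n}(\mathcal C)$, $n\ge 0$, are induced by the restriction of cochains from $\mathcal C[M]$ to its full subcategory $\mathcal C$. -/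

import Mathlib

open CategoryTheory

universe u

noncomputable section

/-! ### Right modules over a `k`-linear category -/

section RightModules

open Limits

variable (k : Type u) [Field k] (C : Type u) [SmallCategory C] [Preadditive C] [Linear k C]

/-- A contravariant functor from `C` to `k`-vector spaces is `k`-linear if it is `k`-linear
on spaces of morphisms. -/
def IsContraLinear : ObjectProperty (Cᵒᵖ ⥤ ModuleCat.{u} k) := fun F =>
  (∀ {x y : C} (f g : x ⟶ y), F.map (f + g).op = F.map f.op + F.map g.op) ∧
    ∀ {x y : C} (r : k) (f : x ⟶ y), F.map (r • f).op = r • F.map f.op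

variable {k C}

lemma IsContraLinear.of_mono {F G : Cᵒᵖ ⥤ ModuleCat.{u} k} (hG : IsContraLinear k C G)
    (i : F ⟶ G) [Mono i] : IsContraLinear k C F := by
  refine ⟨fun {x y} f g => ?_, fun {x y} r f => ?_⟩
  · rw [← cancel_mono (i.app _)]
    simp only [NatTrans.naturality, hG.1, Preadditive.comp_add, Preadditive.add_comp]
  · rw [← cancel_mono (i.app _)]
    simp only [NatTrans.naturality, hG.2, Linear.comp_smul, Linear.smul_comp]

lemma IsContraLinear.of_epi {F G : Cᵒᵖ ⥤ ModuleCat.{u} k} (hF : IsContraLinear k C F)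
    (p : F ⟶ G) [Epi p] : IsContraLinear k C G := by
  refine ⟨fun {x y} f g => ?_, fun {x y} r f => ?_⟩
  · rw [← cancel_epi (p.app _)]
    simp only [← NatTrans.naturality, hF.1, Preadditive.comp_add, Preadditive.add_comp]
  · rw [← cancel_epi (p.app _)]
    simp only [← NatTrans.naturality, hF.2, Linear.comp_smul, Linear.smul_comp]

instance : (IsContraLinear k C).ContainsZero where
  exists_zero := ⟨(Functor.const _).obj (ModuleCat.of k PUnit),
    (Functor.isZero_iff _).2 fun _ =>
      ModuleCat.isZero_of_subsingleton (ModuleCat.of k PUnit.{u + 1}), by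
    have h : ∀ X : Cᵒᵖ, IsZero (((Functor.const Cᵒᵖ).obj (ModuleCat.of k PUnit.{u + 1})).obj X) :=
      fun _ => ModuleCat.isZero_of_subsingleton (ModuleCat.of k PUnit.{u + 1})
    exact ⟨fun _ _ => (h _).eq_of_src _ _, fun _ _ => (h _).eq_of_src _ _⟩⟩

instance : (IsContraLinear k C).IsClosedUnderKernels where
  kernels_le := by
    rintro _ ⟨f, c, hc, h⟩
    have : Mono c.ι := mono_of_isLimit_fork hc
    exact IsContraLinear.of_mono h.1 c.ι

instance : (IsContraLinear k C).IsClosedUnderCokernels where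
  cokernels_le := by
    rintro _ ⟨f, c, hc, h⟩
    have : Epi c.π := epi_of_isColimit_cofork hc
    exact IsContraLinear.of_epi h.2 c.π

instance : (IsContraLinear k C).IsClosedUnderFiniteProducts where
  isClosedUnderLimitsOfShape n := by
    refine ⟨?_⟩
    rintro F ⟨h⟩
    have key : ∀ (X Y : Cᵒᵖ) (a b : F.obj X ⟶ F.obj Y),
        (∀ j, a ≫ (h.π.app j).app Y = b ≫ (h.π.app j).app Y) → a = b := fun X Y a b hab =>
      (isLimitOfPreserves ((evaluation _ _).obj Y) h.isLimit).hom_ext hab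
    refine ⟨fun {x y} f g => key _ _ _ _ fun j => ?_, fun {x y} r f => key _ _ _ _ fun j => ?_⟩
    · simp only [NatTrans.naturality, (h.prop_diag_obj j).1, Preadditive.comp_add,
        Preadditive.add_comp]
    · simp only [NatTrans.naturality, (h.prop_diag_obj j).2, Linear.comp_smul, Linear.smul_comp]

variable (k C)

/-- The category of right `C`-modules: `k`-linear functors from `Cᵒᵖ` to `k`-vector spaces, with
natural transformations as morphisms. -/
abbrev RightMod := (IsContraLinear k C).FullSubcategory

instance : HasExt.{u + 1} (RightMod k C) := HasExt.standard _

end RightModules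

/-! ### The one-point extension -/

section OnePoint

variable {k : Type u} [Field k] {C : Type u} [SmallCategory C] [Preadditive C] [Linear k C]

/-- The objects of the one-point extension of `C` by `M`: those of `C` and one new object. -/
inductive OnePointExt (M : RightMod k C) : Type u
  | of (x : C) : OnePointExt M
  | pt : OnePointExt M

namespace OnePointExt

variable {M : RightMod k C}

/-- Morphisms of the one-point extension. -/
def Hom : OnePointExt M → OnePointExt M → Type u
  | of x, of y => x ⟶ y
  | of x, pt => M.obj.obj (Opposite.op x)
  | pt, of _ => PUnit
  | pt, pt => k

instance : ∀ X Y : OnePointExt M, AddCommGroup (Hom X Y)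
  | of x, of y => inferInstanceAs (AddCommGroup (x ⟶ y))
  | of x, pt => inferInstanceAs (AddCommGroup (M.obj.obj (Opposite.op x)))
  | pt, of _ => inferInstanceAs (AddCommGroup PUnit.{u + 1})
  | pt, pt => inferInstanceAs (AddCommGroup k)

instance : ∀ X Y : OnePointExt M, Module k (Hom X Y)
  | of x, of y => inferInstanceAs (Module k (x ⟶ y))
  | of x, pt => inferInstanceAs (Module k (M.obj.obj (Opposite.op x)))
  | pt, of _ => inferInstanceAs (Module k PUnit.{u + 1})
  | pt, pt => inferInstanceAs (Module k k)

/-- Identities of the one-point extension. -/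
def idHom : ∀ X : OnePointExt M, Hom X X
  | of x => 𝟙 x
  | pt => (1 : k)

/-- Composition (in diagrammatic order) of the one-point extension: composition in `C`, the
action of `C` on `M`, the action of `k` on `M`, and multiplication of `k`. -/
def compHom : ∀ {X Y Z : OnePointExt M}, Hom X Y → Hom Y Z → Hom X Z
  | of _, of _, of _ => fun f g => f ≫ g
  | of _, of _, pt => fun f m => M.obj.map (Quiver.Hom.op f) m
  | of _, pt, of _ => fun _ _ => 0
  | of x, pt, pt => fun m a => (show k from a) • (show M.obj.obj (Opposite.op x) from m)
  | pt, of _, of _ => fun _ _ => 0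
  | pt, of _, pt => fun _ _ => 0
  | pt, pt, of _ => fun _ _ => 0
  | pt, pt, pt => fun a b => (show k from b) * (show k from a)

lemma map_zero_apply (x y : C) (m : M.obj.obj (Opposite.op y)) :
    M.obj.map (Quiver.Hom.op (0 : x ⟶ y)) m = 0 := by
  have h : M.obj.map (Quiver.Hom.op (0 : x ⟶ y)) = 0 := by
    have := M.property.1 (0 : x ⟶ y) 0
    rw [add_zero] at this
    simpa using this
  rw [h]
  rfl

instance : Category (OnePointExt M) where
  Hom := Hom
  id := idHom
  comp := compHom
  id_comp := by
    rintro (x | _) (y | _) f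
    · exact Category.id_comp (X := x) (Y := y) f
    · exact congrArg (fun g => g.hom f) (M.obj.map_id (Opposite.op x))
    · rfl
    · exact mul_one (M := k) f
  comp_id := by
    rintro (x | _) (y | _) f
    · exact Category.comp_id (X := x) (Y := y) f
    · exact one_smul k (show M.obj.obj (Opposite.op x) from f)
    · rfl
    · exact one_mul (M := k) f
  assoc := by
    rintro (x | _) (y | _) (z | _) (w | _) f g h
    · exact Category.assoc (W := x) (X := y) (Y := z) (Z := w) f g h
    · exact congrArg (fun g => g.hom h) (M.obj.map_comp (Quiver.Hom.op (V := C) (X := y) (Y := z) g)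
        (Quiver.Hom.op (V := C) (X := x) (Y := y) f))
    · exact (Limits.comp_zero (f := (show x ⟶ y from f)) (Z := w)).symm
    · exact ((M.obj.map (Quiver.Hom.op (V := C) (X := x) (Y := y) f)).hom.map_smul
        (show k from h) (show M.obj.obj (Opposite.op y) from g)).symm
    · exact Limits.zero_comp (f := (show z ⟶ w from h))
    · exact (map_zero_apply x z h).trans (zero_smul k (show M.obj.obj (Opposite.op x) from f)).symm
    · rfl
    · exact smul_smul (show k from h) (show k from g) (show M.obj.obj (Opposite.op x) from f)
    · rfl
    · rfl
    · rfl
    · exact mul_zero (show k from h)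
    · rfl
    · exact (zero_mul (show k from f)).symm
    · rfl
    · exact (mul_assoc (show k from h) (show k from g) (show k from f)).symm

instance : Preadditive (OnePointExt M) where
  homGroup := fun X Y => inferInstanceAs (AddCommGroup (Hom X Y))
  add_comp := by
    rintro (x | _) (y | _) (z | _) f g h
    · exact Preadditive.add_comp (P := x) (Q := y) (R := z) _ _ _
    · exact congrArg (fun q => q.hom h) (M.property.1 (x := x) (y := y) f g)
    · exact (add_zero (0 : x ⟶ z)).symm
    · exact smul_add (show k from h) (show M.obj.obj (Opposite.op x) from f)
        (show M.obj.obj (Opposite.op x) from g)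
    · rfl
    · exact (add_zero (0 : k)).symm
    · rfl
    · exact mul_add (show k from h) (show k from f) (show k from g)
  comp_add := by
    rintro (x | _) (y | _) (z | _) f g h
    · exact Preadditive.comp_add (P := x) (Q := y) (R := z) _ _ _
    · exact (M.obj.map (Quiver.Hom.op (V := C) (X := x) (Y := y) f)).hom.map_add
        (show M.obj.obj (Opposite.op y) from g) (show M.obj.obj (Opposite.op y) from h)
    · exact (add_zero (0 : x ⟶ z)).symm
    · exact add_smul (show k from g) (show k from h) (show M.obj.obj (Opposite.op x) from f)
    · rfl
    · exact (add_zero (0 : k)).symm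
    · rfl
    · exact add_mul (show k from g) (show k from h) (show k from f)

instance : Linear k (OnePointExt M) where
  homModule := fun X Y => inferInstanceAs (Module k (Hom X Y))
  smul_comp := by
    rintro (x | _) (y | _) (z | _) r f g
    · exact Linear.smul_comp (C := C) x y z r f g
    · exact congrArg (fun q => q.hom g) (M.property.2 (x := x) (y := y) r f)
    · exact (smul_zero r : r • (0 : x ⟶ z) = 0).symm
    · exact smul_comm (show k from g) r (show M.obj.obj (Opposite.op x) from f)
    · rfl
    · exact (smul_zero r : r • (0 : k) = 0).symm
    · rfl
    · exact mul_smul_comm r (show k from g) (show k from f)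
  comp_smul := by
    rintro (x | _) (y | _) (z | _) f r g
    · exact Linear.comp_smul (C := C) x y z f r g
    · exact (M.obj.map (Quiver.Hom.op (V := C) (X := x) (Y := y) f)).hom.map_smul r
        (show M.obj.obj (Opposite.op y) from g)
    · exact (smul_zero r : r • (0 : x ⟶ z) = 0).symm
    · exact mul_smul r (show k from g) (show M.obj.obj (Opposite.op x) from f)
    · rfl
    · exact (smul_zero r : r • (0 : k) = 0).symm
    · rfl
    · exact smul_mul_assoc r (show k from g) (show k from f)

variable (M) in
/-- The inclusion of `C` in its one-point extension. -/
def incl : C ⥤ OnePointExt M where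
  obj := of
  map f := f

variable (M) in
/-- The inclusion of `C` in its one-point extension is fully faithful. -/
def inclFullyFaithful : (incl M).FullyFaithful where
  preimage f := f

instance : (incl M).Additive where
instance : (incl M).Linear k where

end OnePointExt
end OnePoint

/-! ### Hochschild-Mitchell cohomology -/

namespace HochschildMitchell

section Segments

variable {C : Type u} [SmallCategory C]

/-- The composite `x a ⟶ x b` of a string of composable morphisms. -/
def seg {n : ℕ} (x : Fin (n + 1) → C) (f : ∀ i : Fin n, x i.castSucc ⟶ x i.succ)
    {a b : Fin (n + 1)} (h : a ≤ b) : x a ⟶ x b :=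
  (ComposableArrows.mkOfObjOfMapSucc x f).map (homOfLE h)

variable {n : ℕ} (x : Fin (n + 1) → C) (f : ∀ i : Fin n, x i.castSucc ⟶ x i.succ)

@[simp]
lemma seg_refl (a : Fin (n + 1)) : seg x f (le_refl a) = 𝟙 (x a) :=
  (ComposableArrows.mkOfObjOfMapSucc x f).map_id a

lemma seg_trans {a b c : Fin (n + 1)} (h : a ≤ b) (h' : b ≤ c) :
    seg x f h ≫ seg x f h' = seg x f (h.trans h') :=
  ((ComposableArrows.mkOfObjOfMapSucc x f).map_comp (homOfLE h) (homOfLE h')).symm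

lemma seg_succ (i : Fin n) : seg x f i.castSucc_lt_succ.le = f i :=
  ComposableArrows.mkOfObjOfMapSucc_map_succ x f i.1 i.2

/-- Induction principle for statements on `seg`. -/
lemma seg_induction {a : Fin (n + 1)} (P : ∀ b : Fin (n + 1), a ≤ b → Prop)
    (h0 : P a le_rfl)
    (hs : ∀ (i : Fin n) (h : a ≤ i.castSucc), P i.castSucc h →
      P i.succ (h.trans i.castSucc_lt_succ.le))
    (b : Fin (n + 1)) (h : a ≤ b) : P b h := by
  induction b using Fin.induction with
  | zero =>
    obtain rfl : a = 0 := le_antisymm h (Fin.zero_le _)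
    exact h0
  | succ i ih =>
    by_cases hi : a ≤ i.castSucc
    · exact hs i hi (ih hi)
    · obtain rfl : a = i.succ := le_antisymm h (Fin.castSucc_lt_iff_succ_le.1 (not_le.1 hi))
      exact h0

lemma seg_congr {f f' : ∀ i : Fin n, x i.castSucc ⟶ x i.succ} {a b : Fin (n + 1)} (h : a ≤ b)
    (hf : ∀ i : Fin n, a ≤ i.castSucc → i.castSucc < b → f i = f' i) :
    seg x f h = seg x f' h := by
  revert hf
  refine seg_induction (a := a) (fun b h => (∀ i : Fin n, a ≤ i.castSucc → i.castSucc < b →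
    f i = f' i) → seg x f h = seg x f' h) (fun _ => by simp) (fun i hi ih hf => ?_) b h
  rw [← seg_trans x f hi i.castSucc_lt_succ.le, ← seg_trans x f' hi i.castSucc_lt_succ.le,
    seg_succ, seg_succ, hf i hi i.castSucc_lt_succ,
    ih fun j hj hj' => hf j hj (hj'.trans i.castSucc_lt_succ)]

/-- The composable string obtained from a string by a monotone map of indices. -/
def reindex {m : ℕ} (σ : Fin (m + 1) →o Fin (n + 1)) (i : Fin m) :
    (x ∘ σ) i.castSucc ⟶ (x ∘ σ) i.succ :=
  seg x f (σ.monotone i.castSucc_lt_succ.le)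

lemma seg_reindex {m : ℕ} (σ : Fin (m + 1) →o Fin (n + 1)) {a b : Fin (m + 1)} (h : a ≤ b) :
    seg (x ∘ σ) (reindex x f σ) h = seg x f (σ.monotone h) := by
  refine seg_induction (a := a) (fun b h => seg (x ∘ σ) (reindex x f σ) h =
    seg x f (σ.monotone h)) ?_ (fun i hi ih => ?_) b h
  · rw [seg_refl]
    exact (seg_refl x f (σ a)).symm
  · rw [← seg_trans _ _ hi i.castSucc_lt_succ.le, ih, seg_succ]
    exact seg_trans x f _ _

lemma map_seg {D : Type u} [SmallCategory D] (F : C ⥤ D) {a b : Fin (n + 1)} (h : a ≤ b) :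
    F.map (seg x f h) = seg (F.obj ∘ x) (fun i => F.map (f i)) h := by
  refine seg_induction (a := a) (fun b h => F.map (seg x f h) =
    seg (F.obj ∘ x) (fun i => F.map (f i)) h) (by simp) (fun i hi ih => ?_) b h
  rw [← seg_trans _ _ hi i.castSucc_lt_succ.le, ← seg_trans _ _ hi i.castSucc_lt_succ.le,
    F.map_comp, ih, seg_succ, seg_succ]

lemma seg_update {a b : Fin (n + 1)} (m : Fin n) (ha : a ≤ m.castSucc) (hb : m.succ ≤ b)
    (v : x m.castSucc ⟶ x m.succ) :
    seg x (Function.update f m v) (ha.trans (m.castSucc_lt_succ.le.trans hb)) =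
      seg x f ha ≫ v ≫ seg x f hb := by
  rw [← seg_trans x _ ha (m.castSucc_lt_succ.le.trans hb),
    ← seg_trans x _ m.castSucc_lt_succ.le hb, seg_succ, Function.update_self]
  congr 1
  · refine seg_congr x _ fun i _ hi => Function.update_of_ne ?_ _ _
    rintro rfl
    exact lt_irrefl _ hi
  · congr 1
    refine seg_congr x _ fun i hi _ => Function.update_of_ne ?_ _ _
    rintro rfl
    exact absurd hi (not_le.2 i.castSucc_lt_succ)

lemma seg_update_of_not {a b : Fin (n + 1)} (h : a ≤ b) (m : Fin n)
    (hm : ¬ (a ≤ m.castSucc ∧ m.succ ≤ b)) (v : x m.castSucc ⟶ x m.succ) :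
    seg x (Function.update f m v) h = seg x f h := by
  refine seg_congr x h fun i hi hi' => Function.update_of_ne ?_ _ _
  rintro rfl
  exact hm ⟨hi, Fin.castSucc_lt_iff_succ_le.1 hi'⟩

end Segments

section Complex

variable (k : Type u) [Field k] (C : Type u) [SmallCategory C] [Preadditive C] [Linear k C]

/-- Hochschild-Mitchell `n`-cochains of `C` with coefficients in the bimodule `C`: families,
indexed by the `(n + 1)`-tuples `(x 0, …, x n)` of objects, of `k`-linear maps
`C(x 0, x 1) ⊗ ⋯ ⊗ C(x (n-1), x n) → C(x 0, x n)`, that is, of `k`-multilinear maps. -/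
abbrev Cochain (n : ℕ) : Type u :=
  ∀ x : Fin (n + 1) → C,
    MultilinearMap k (fun i : Fin n => x i.castSucc ⟶ x i.succ) (x 0 ⟶ x (Fin.last n))

variable {k C}

/-- The value on `f` of the cochain deduced from `φ` by a monotone map `σ`. -/
def pullFun {m n : ℕ} (σ : Fin (m + 1) →o Fin (n + 1)) (φ : Cochain k C m)
    (x : Fin (n + 1) → C) (f : ∀ i : Fin n, x i.castSucc ⟶ x i.succ) : x 0 ⟶ x (Fin.last n) :=
  seg x f (Fin.zero_le (σ 0)) ≫ φ (x ∘ σ) (reindex x f σ) ≫ seg x f (Fin.le_last (σ (Fin.last m)))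

lemma exists_step {m n : ℕ} (σ : Fin (m + 1) →o Fin (n + 1)) (p : Fin n)
    (h0 : σ 0 ≤ p.castSucc) (h1 : p.succ ≤ σ (Fin.last m)) :
    ∃ j : Fin m, σ j.castSucc ≤ p.castSucc ∧ p.succ ≤ σ j.succ := by
  by_contra! H
  have : ∀ j : Fin (m + 1), σ j ≤ p.castSucc := by
    intro j
    induction j using Fin.induction with
    | zero => exact h0
    | succ j ih => exact Fin.le_castSucc_iff.2 (H j ih)
  exact absurd (h1.trans (this _)) (not_le.2 p.castSucc_lt_succ)

lemma exists_pullFun_update {m n : ℕ} (σ : Fin (m + 1) →o Fin (n + 1)) (φ : Cochain k C m)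
    (x : Fin (n + 1) → C) (f : ∀ i : Fin n, x i.castSucc ⟶ x i.succ) (p : Fin n) :
    ∃ L : (x p.castSucc ⟶ x p.succ) →ₗ[k] (x 0 ⟶ x (Fin.last n)),
      ∀ v, pullFun σ φ x (Function.update f p v) = L v := by
  have hre : ∀ (v) (i : Fin m), ¬ (σ i.castSucc ≤ p.castSucc ∧ p.succ ≤ σ i.succ) →
      reindex x (Function.update f p v) σ i = reindex x f σ i := fun v i hi =>
    seg_update_of_not x f _ p hi v
  by_cases h0 : p.succ ≤ σ 0
  · refine ⟨Linear.rightComp k _ (seg x f h0 ≫ φ (x ∘ σ) (reindex x f σ) ≫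
      seg x f (Fin.le_last (σ (Fin.last m)))) ∘ₗ
        Linear.leftComp k _ (seg x f (Fin.zero_le p.castSucc)), fun v => ?_⟩
    have h1 : reindex x (Function.update f p v) σ = reindex x f σ := funext fun i => hre v i
      fun hi => absurd ((h0.trans (σ.monotone (Fin.zero_le _))).trans hi.1)
        (not_le.2 p.castSucc_lt_succ)
    have h2 := seg_update_of_not x f (Fin.le_last (σ (Fin.last m))) p
      (fun hi => absurd ((h0.trans (σ.monotone (Fin.zero_le _))).trans hi.1)
        (not_le.2 p.castSucc_lt_succ)) v
    simp only [pullFun, h1, h2, seg_update x f p (Fin.zero_le _) h0, Category.assoc,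
      LinearMap.comp_apply, Linear.leftComp_apply, Linear.rightComp_apply]
  by_cases h1 : σ (Fin.last m) ≤ p.castSucc
  · refine ⟨Linear.leftComp k _ (seg x f (Fin.zero_le (σ 0)) ≫ φ (x ∘ σ) (reindex x f σ) ≫
      seg x f h1) ∘ₗ Linear.rightComp k _ (seg x f (Fin.le_last p.succ)), fun v => ?_⟩
    have h2 : reindex x (Function.update f p v) σ = reindex x f σ := funext fun i => hre v i
      fun hi => absurd ((hi.2.trans (σ.monotone (Fin.le_last _))).trans h1)
        (not_le.2 p.castSucc_lt_succ)
    have h3 := seg_update_of_not x f (Fin.zero_le (σ 0)) p (fun hi => h0 hi.2) v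
    simp only [pullFun, h2, h3, seg_update x f p h1 (Fin.le_last _), Category.assoc,
      LinearMap.comp_apply, Linear.leftComp_apply, Linear.rightComp_apply]
  · obtain ⟨j, hj, hj'⟩ := exists_step σ p (Fin.le_castSucc_iff.2 (not_le.1 h0))
      (Fin.castSucc_lt_iff_succ_le.1 (not_le.1 h1))
    refine ⟨Linear.leftComp k _ (seg x f (Fin.zero_le (σ 0))) ∘ₗ
      Linear.rightComp k _ (seg x f (Fin.le_last (σ (Fin.last m)))) ∘ₗ
        (φ (x ∘ σ)).toLinearMap (reindex x f σ) j ∘ₗ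
          Linear.leftComp k _ (seg x f hj) ∘ₗ Linear.rightComp k _ (seg x f hj'), fun v => ?_⟩
    have h2 : reindex x (Function.update f p v) σ =
        Function.update (reindex x f σ) j (seg x f hj ≫ v ≫ seg x f hj') := by
      funext i
      by_cases hi : i = j
      · subst hi
        rw [Function.update_self]
        exact seg_update x f p hj hj' v
      · rw [Function.update_of_ne hi]
        refine hre v i fun hi' => ?_
        rcases lt_or_gt_of_ne hi with hlt | hlt
        · exact absurd ((hi'.2.trans (σ.monotone (Fin.succ_le_castSucc_iff.2 hlt))).trans hj)
            (not_le.2 p.castSucc_lt_succ)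
        · exact absurd ((hj'.trans (σ.monotone (Fin.succ_le_castSucc_iff.2 hlt))).trans hi'.1)
            (not_le.2 p.castSucc_lt_succ)
    have h3 := seg_update_of_not x f (Fin.zero_le (σ 0)) p (fun hi => h0 hi.2) v
    have h4 := seg_update_of_not x f (Fin.le_last (σ (Fin.last m))) p (fun hi => h1 hi.1) v
    simp only [pullFun, h2, h3, h4, LinearMap.comp_apply, Linear.leftComp_apply,
      Linear.rightComp_apply, MultilinearMap.toLinearMap_apply]

/-- The `k`-linear map on cochains induced by a monotone map `σ`, which sends `φ` to
`(f 1, …, f n) ↦ (f 1 ⋯ f (σ 0)) φ(…, f (σ (i-1) + 1) ⋯ f (σ i), …) (f (σ m + 1) ⋯ f n)`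
(products in diagrammatic order). -/
def pull {m n : ℕ} (σ : Fin (m + 1) →o Fin (n + 1)) : Cochain k C m →ₗ[k] Cochain k C n where
  toFun φ x :=
    { toFun := pullFun σ φ x
      map_update_add' := fun {inst} f p v w => by
        obtain rfl : inst = instDecidableEqFin n := Subsingleton.elim _ _
        obtain ⟨L, hL⟩ := exists_pullFun_update σ φ x f p
        simp only [hL, map_add]
      map_update_smul' := fun {inst} f p c v => by
        obtain rfl : inst = instDecidableEqFin n := Subsingleton.elim _ _
        obtain ⟨L, hL⟩ := exists_pullFun_update σ φ x f p
        simp only [hL, map_smul] }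
  map_add' φ ψ := by
    ext x f
    simp [pullFun]
  map_smul' r φ := by
    ext x f
    simp [pullFun]

lemma pull_apply {m n : ℕ} (σ : Fin (m + 1) →o Fin (n + 1)) (φ : Cochain k C m)
    (x : Fin (n + 1) → C) (f : ∀ i : Fin n, x i.castSucc ⟶ x i.succ) :
    pull σ φ x f = seg x f (Fin.zero_le (σ 0)) ≫ φ (x ∘ σ) (reindex x f σ) ≫
      seg x f (Fin.le_last (σ (Fin.last m))) := rfl

lemma pull_id (n : ℕ) : pull (k := k) (C := C) (OrderHom.id : Fin (n + 1) →o _) =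
    LinearMap.id := by
  ext φ x f
  have h : reindex x f OrderHom.id = f := funext fun i => seg_succ x f i
  have h0 : seg x f (Fin.zero_le ((OrderHom.id : Fin (n + 1) →o _) 0)) = 𝟙 _ := seg_refl x f 0
  have h1 : seg x f (Fin.le_last ((OrderHom.id : Fin (n + 1) →o _) (Fin.last n))) = 𝟙 _ :=
    seg_refl x f _
  rw [pull_apply, h, h0, h1]
  exact (Category.id_comp _).trans (Category.comp_id _)

lemma pull_comp {l m n : ℕ} (σ : Fin (l + 1) →o Fin (m + 1)) (τ : Fin (m + 1) →o Fin (n + 1)) :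
    pull (k := k) (C := C) (τ.comp σ) = pull τ ∘ₗ pull σ := by
  ext φ x f
  rw [LinearMap.comp_apply, pull_apply, pull_apply, pull_apply]
  have h : reindex (x ∘ τ) (reindex x f τ) σ = reindex x f (τ.comp σ) :=
    funext fun i => seg_reindex x f τ _
  rw [h, seg_reindex, seg_reindex]
  have h0 := seg_trans x f (Fin.zero_le (τ 0)) (τ.monotone (Fin.zero_le (σ 0)))
  have h1 := seg_trans x f (τ.monotone (Fin.le_last (σ (Fin.last l)))) (Fin.le_last _)
  have key : ∀ {a b c d e g : C} {p : a ⟶ b} {q : b ⟶ c} {pq : a ⟶ c} {s : d ⟶ e} {t : e ⟶ g}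
      {st : d ⟶ g} (r : c ⟶ d), p ≫ q = pq → s ≫ t = st →
      pq ≫ r ≫ st = p ≫ (q ≫ r ≫ s) ≫ t := by
    rintro _ _ _ _ _ _ _ _ _ _ _ _ r rfl rfl
    simp
  exact key _ h0 h1

variable (k C)

/-- The cosimplicial `k`-vector space of Hochschild-Mitchell cochains. -/
def cosimplicial : CosimplicialObject (ModuleCat.{u} k) where
  obj n := ModuleCat.of k (Cochain k C n.len)
  map σ := ModuleCat.ofHom (pull σ.toOrderHom)
  map_id n := by
    apply ModuleCat.hom_ext
    exact pull_id _
  map_comp σ τ := by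
    apply ModuleCat.hom_ext
    exact pull_comp _ _

/-- The Hochschild-Mitchell cochain complex of `C` with coefficients in `C`. Its differential is
`∑ (-1) ^ i δ i`, with `δ 0 φ (f 1, …, f n) = f 1 φ(f 2, …, f n)`,
`δ i φ (f 1, …, f n) = φ(…, f i f (i+1), …)` for `0 < i < n` and
`δ n φ (f 1, …, f n) = φ(f 1, …, f (n-1)) f n` (products in diagrammatic order). -/
def complex : CochainComplex (ModuleCat.{u} k) ℕ :=
  (AlgebraicTopology.alternatingCofaceMapComplex _).obj (cosimplicial k C)

lemma complex_d_apply (n : ℕ) (φ : Cochain k C n) :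
    ((complex k C).d n (n + 1)).hom φ =
      ∑ i : Fin (n + 2), (-1 : ℤ) ^ (i : ℕ) • pull (Fin.succAboveOrderEmb i).toOrderHom φ := by
  have h : (complex k C).d n (n + 1) =
      ∑ i : Fin (n + 2), (-1 : ℤ) ^ (i : ℕ) •
        ModuleCat.ofHom (pull (k := k) (C := C) (Fin.succAboveOrderEmb i).toOrderHom) :=
    CochainComplex.of_d _ (AlgebraicTopology.AlternatingCofaceMapComplex.objD (cosimplicial k C)) n
  rw [h]
  let ev : (ModuleCat.of k (Cochain k C n) ⟶ ModuleCat.of k (Cochain k C (n + 1))) →+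
      Cochain k C (n + 1) :=
    { toFun := fun l => l.hom φ
      map_zero' := rfl
      map_add' := fun _ _ => rfl }
  refine (map_sum ev _ _).trans (Finset.sum_congr rfl fun i _ => ?_)
  rw [map_zsmul]
  rfl

/-- Hochschild-Mitchell cohomology `HH^n(C) = H^n(C, C)`. -/
abbrev HH (n : ℕ) : ModuleCat.{u} k := (complex k C).homology n

end Complex

section Restriction

variable {k : Type u} [Field k] {C D : Type u} [SmallCategory C] [Preadditive C] [Linear k C]
  [SmallCategory D] [Preadditive D] [Linear k D]
  {F : C ⥤ D} (hF : F.FullyFaithful) [F.Additive] [F.Linear k]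

/-- Restriction of cochains along a fully faithful `k`-linear functor. -/
def restrictCochain (n : ℕ) : Cochain k D n →ₗ[k] Cochain k C n where
  toFun φ x :=
    let e : (F.obj (x 0) ⟶ F.obj (x (Fin.last n))) →ₗ[k] (x 0 ⟶ x (Fin.last n)) :=
      { toFun := hF.preimage
        map_add' := fun a b => hF.map_injective (by simp)
        map_smul' := fun r a => hF.map_injective (by simp) }
    e.compMultilinearMap
      ((φ (F.obj ∘ x)).compLinearMap fun i => F.mapLinearMap k)
  map_add' φ ψ := by
    ext x f
    exact hF.map_injective (by simp)
  map_smul' r φ := by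
    ext x f
    exact hF.map_injective (by simp)

lemma map_restrictCochain {n : ℕ} (φ : Cochain k D n) (x : Fin (n + 1) → C)
    (f : ∀ i : Fin n, x i.castSucc ⟶ x i.succ) :
    F.map (restrictCochain hF n φ x f) = φ (F.obj ∘ x) (fun i => F.map (f i)) :=
  hF.map_preimage _

/-- Restriction of cochains as a morphism of cosimplicial vector spaces. -/
def restrictCosimplicial : cosimplicial k D ⟶ cosimplicial k C where
  app n := ModuleCat.ofHom (restrictCochain hF n.len)
  naturality m n σ := by
    apply ModuleCat.hom_ext
    apply LinearMap.ext
    intro (φ : Cochain k D m.len)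
    funext x
    apply MultilinearMap.ext
    intro f
    apply hF.map_injective
    change F.map (restrictCochain hF _ (pull σ.toOrderHom φ) x f) =
      F.map (pull σ.toOrderHom (restrictCochain hF _ φ) x f)
    rw [map_restrictCochain, pull_apply]
    erw [pull_apply]
    rw [F.map_comp, F.map_comp, map_restrictCochain,
      map_seg, map_seg]
    have : (fun i => F.map (reindex x f σ.toOrderHom i)) =
        reindex (F.obj ∘ x) (fun i => F.map (f i)) σ.toOrderHom := by
      funext i
      exact map_seg x f F _
    rw [this]
    rfl

/-- The map `HH^n(D) → HH^n(C)` induced by restriction of cochains along a fully faithful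
`k`-linear functor `C ⥤ D`. -/
def restrictHH (n : ℕ) : HH k D n →ₗ[k] HH k C n :=
  (HomologicalComplex.homologyMap
    ((AlgebraicTopology.alternatingCofaceMapComplex _).map (restrictCosimplicial hF)) n).hom

/-- The map `HH^n(C[M]) → HH^n(C)` induced by restriction of cochains from the one-point extension
`C[M]` to its full subcategory `C`. -/
def restrictOnePoint (M : RightMod k C) (n : ℕ) : HH k (OnePointExt M) n →ₗ[k] HH k C n :=
  restrictHH (OnePointExt.inclFullyFaithful M) n

end Restriction

end HochschildMitchell

end

/-! Restriction of cochains from `C[M]` to `C` is surjective; let `K` be its kernel. The asserted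
sequence is the long exact sequence of `0 → K → complex(C[M]) → complex(C) → 0`, once the cohomology
of `K` is known: `H^0(K) = 0`, `H^1(K) = Hom(M, M)/k`, and `H^{n+2}(K) = Ext^{n+1}(M, M)`.

To compute it, let `P = Hom(-, *)` be the right `C[M]`-module represented by the new object. Its
restriction to `C` is `M`. Cochains of `C[M]` act on `P`, and this action gives a short exact
sequence `0 → K → homComplex(P, P) → homComplex(M, M) → 0` (`ptRestrictSequence_shortExact`). The
reason is a case distinction on strings of objects. If a string ends at `*`, then `Hom(y, *) =
Hom_k(P_*, P_y)` because `P_* = k`, so cochains with values in either bimodule agree. If a string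
lies in `C`, elements of `K` and of the kernel on the right both vanish there. Any other string
contains a step from `*` to an object of `C`, where the space of morphisms is zero.

For all right modules `N`, `M` over a `k`-linear category, `homComplex N M` computes `Ext(N, M)`
(`nonempty_homology_equiv_ext`). Degree zero is checked directly. Higher degrees follow by dimension
shifting along the embedding of `M` in the coinduced module `coind M`, which is injective and for
which the complex is acyclic in positive degrees by an explicit contraction.

Since `P` is projective and `End(P) = k`, the middle complex has cohomology `k` in degree zero only.
The map `k → Hom(M, M)` sends a scalar to that multiple of the identity
(`homologyZeroEquiv_ptRestrict`), so it is injective when `M ≠ 0` and has cokernel `Hom(M, M)/k`.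
Connecting maps give the rest. -/

noncomputable section

/-! ### The action of a category on its right modules -/

namespace RightMod

open Opposite Limits

variable {k : Type u} [Field k] {C : Type u} [SmallCategory C] [Preadditive C] [Linear k C]

/-- The vector space that a right module attaches to an object. -/
abbrev fiber (M : RightMod k C) (x : C) : Type u := M.obj.obj (op x)

/-- The action of morphisms of `C` on a right module, as a linear map. -/
def act (M : RightMod k C) (x y : C) : (x ⟶ y) →ₗ[k] (M.fiber y →ₗ[k] M.fiber x) where
  toFun f := (M.obj.map f.op).hom
  map_add' f g := congrArg ModuleCat.Hom.hom (M.property.1 f g)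
  map_smul' r f := congrArg ModuleCat.Hom.hom (M.property.2 r f)

lemma act_id (M : RightMod k C) (x : C) : M.act x x (𝟙 x) = LinearMap.id :=
  congrArg ModuleCat.Hom.hom (M.obj.map_id (op x))

lemma act_comp (M : RightMod k C) {x y z : C} (f : x ⟶ y) (g : y ⟶ z) :
    M.act x z (f ≫ g) = M.act x y f ∘ₗ M.act y z g :=
  congrArg ModuleCat.Hom.hom (M.obj.map_comp g.op f.op)

/-- The component at `x` of a morphism of right modules. -/
def component {M N : RightMod k C} (p : M ⟶ N) (x : C) : M.fiber x →ₗ[k] N.fiber x :=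
  (p.hom.app (op x)).hom

lemma component_act {M N : RightMod k C} (p : M ⟶ N) {x y : C} (f : x ⟶ y) :
    component p x ∘ₗ M.act x y f = N.act x y f ∘ₗ component p y :=
  congrArg ModuleCat.Hom.hom (p.hom.naturality f.op)

lemma component_ext {M N : RightMod k C} {p q : M ⟶ N} (h : ∀ x, component p x = component q x) :
    p = q := by
  apply ObjectProperty.hom_ext
  apply NatTrans.ext
  funext x
  exact ModuleCat.hom_ext (h x.unop)

/-- Constructor for morphisms of right modules. -/
def mkHom {M N : RightMod k C} (a : ∀ x, M.fiber x →ₗ[k] N.fiber x)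
    (h : ∀ {x y : C} (f : x ⟶ y), a x ∘ₗ M.act x y f = N.act x y f ∘ₗ a y) : M ⟶ N :=
  ObjectProperty.homMk
    { app := fun x => ModuleCat.ofHom (a x.unop)
      naturality := fun _ _ f => ModuleCat.hom_ext (h f.unop) }

lemma component_comp {M N Q : RightMod k C} (p : M ⟶ N) (q : N ⟶ Q) (x : C) :
    component (p ≫ q) x = component q x ∘ₗ component p x := rfl

lemma component_zero (M N : RightMod k C) (x : C) : component (0 : M ⟶ N) x = 0 := rfl

/-- The inclusion of right modules in all functors preserves monomorphisms, and for functors these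
are detected at each object. -/
lemma component_injective_of_mono {M N : RightMod k C} (p : M ⟶ N) [Mono p] (x : C) :
    Function.Injective (component p x) := by
  have := (IsContraLinear k C).preservesMonomorphisms_ι_of_isNormalEpiCategory
  have h1 : Mono ((IsContraLinear k C).ι.map p) := inferInstance
  exact (ModuleCat.mono_iff_injective _).1 ((NatTrans.mono_iff_mono_app _).1 h1 (op x))

lemma component_surjective_of_epi {M N : RightMod k C} (p : M ⟶ N) [Epi p] (x : C) :
    Function.Surjective (component p x) := by
  have := (IsContraLinear k C).preservesEpimorphisms_ι_of_isNormalMonoCategory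
  have h1 : Epi ((IsContraLinear k C).ι.map p) := inferInstance
  exact (ModuleCat.epi_iff_surjective _).1 ((NatTrans.epi_iff_epi_app _).1 h1 (op x))

/-- A short exact sequence of right modules is short exact at every object. -/
lemma shortExact_components {S : ShortComplex (RightMod k C)} (hS : S.ShortExact) (x : C) :
    Function.Injective (component S.f x) ∧ Function.Exact (component S.f x) (component S.g x) ∧
      Function.Surjective (component S.g x) := by
  have := hS.mono_f
  have := hS.epi_g
  have e : (S.map (IsContraLinear k C).ι).Exact := by
    have := (IsContraLinear k C).preservesKernels_ι S.g
    exact ShortComplex.exact_of_f_is_kernel (S.map (IsContraLinear k C).ι)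
      (KernelFork.mapIsLimit _ hS.fIsKernel (IsContraLinear k C).ι)
  exact ⟨component_injective_of_mono S.f x,
    (ShortComplex.ShortExact.moduleCat_exact_iff_function_exact _).1
      (e.map ((evaluation _ _).obj (op x))), component_surjective_of_epi S.g x⟩

end RightMod

/-! ### The Hochschild-Mitchell complex with coefficients in `Hom_k(N, M)` -/

namespace HochschildMitchell

section HomComplex

open RightMod

variable {k : Type u} [Field k] {C : Type u} [SmallCategory C] [Preadditive C] [Linear k C]

/-- Hochschild-Mitchell `n`-cochains of `C` with coefficients in the bimodule `Hom_k(N, M)`. -/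
abbrev HomCochain (N M : RightMod k C) (n : ℕ) : Type u :=
  ∀ x : Fin (n + 1) → C, MultilinearMap k (fun i : Fin n => x i.castSucc ⟶ x i.succ)
    (N.fiber (x (Fin.last n)) →ₗ[k] M.fiber (x 0))

variable {N M : RightMod k C}

/-- The value on `f` of the cochain with coefficients in `Hom_k(N, M)` deduced from `φ` by a
monotone map `σ`. -/
def homPullFun {m n : ℕ} (σ : Fin (m + 1) →o Fin (n + 1)) (φ : HomCochain N M m)
    (x : Fin (n + 1) → C) (f : ∀ i : Fin n, x i.castSucc ⟶ x i.succ) :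
    N.fiber (x (Fin.last n)) →ₗ[k] M.fiber (x 0) :=
  M.act _ _ (seg x f (Fin.zero_le (σ 0))) ∘ₗ φ (x ∘ σ) (reindex x f σ) ∘ₗ
    N.act _ _ (seg x f (Fin.le_last (σ (Fin.last m))))

/-- This gives multilinearity of a pulled-back cochain: the `p`-th morphism enters exactly one of
the initial segment, one block of `σ`, or the final segment, and each of these enters linearly. -/
lemma exists_homPullFun_update {m n : ℕ} (σ : Fin (m + 1) →o Fin (n + 1)) (φ : HomCochain N M m)
    (x : Fin (n + 1) → C) (f : ∀ i : Fin n, x i.castSucc ⟶ x i.succ) (p : Fin n) :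
    ∃ L : (x p.castSucc ⟶ x p.succ) →ₗ[k] (N.fiber (x (Fin.last n)) →ₗ[k] M.fiber (x 0)),
      ∀ v, homPullFun σ φ x (Function.update f p v) = L v := by
  have hre : ∀ (v) (i : Fin m), ¬ (σ i.castSucc ≤ p.castSucc ∧ p.succ ≤ σ i.succ) →
      reindex x (Function.update f p v) σ i = reindex x f σ i := fun v i hi =>
    seg_update_of_not x f _ p hi v
  have hp : ¬ p.succ ≤ p.castSucc := not_le.2 p.castSucc_lt_succ
  -- The varying morphism lies in the initial segment, which acts on `M`.
  by_cases h0 : p.succ ≤ σ 0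
  · refine ⟨LinearMap.lcomp k _ (M.act _ _ (seg x f h0) ∘ₗ φ (x ∘ σ) (reindex x f σ) ∘ₗ
      N.act _ _ (seg x f (Fin.le_last (σ (Fin.last m))))) ∘ₗ LinearMap.llcomp k _ _ _
        (M.act _ _ (seg x f (Fin.zero_le p.castSucc))) ∘ₗ M.act _ _, fun v => ?_⟩
    have h1 : reindex x (Function.update f p v) σ = reindex x f σ := funext fun i => hre v i
      fun hi => hp ((h0.trans (σ.monotone (Fin.zero_le _))).trans hi.1)
    have h2 := seg_update_of_not x f (Fin.le_last (σ (Fin.last m))) p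
      (fun hi => hp ((h0.trans (σ.monotone (Fin.zero_le _))).trans hi.1)) v
    rw [homPullFun, h1, h2, seg_update x f p (Fin.zero_le _) h0, act_comp, act_comp]
    rfl
  -- The varying morphism lies in the final segment, which acts on `N`.
  by_cases h1 : σ (Fin.last m) ≤ p.castSucc
  · refine ⟨LinearMap.lcomp k _ (N.act _ _ (seg x f (Fin.le_last p.succ))) ∘ₗ
      LinearMap.llcomp k _ _ _ (M.act _ _ (seg x f (Fin.zero_le (σ 0))) ∘ₗ
        φ (x ∘ σ) (reindex x f σ) ∘ₗ N.act _ _ (seg x f h1)) ∘ₗ N.act _ _, fun v => ?_⟩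
    have h2 : reindex x (Function.update f p v) σ = reindex x f σ := funext fun i => hre v i
      fun hi => hp ((hi.2.trans (σ.monotone (Fin.le_last _))).trans h1)
    have h3 := seg_update_of_not x f (Fin.zero_le (σ 0)) p (fun hi => h0 hi.2) v
    rw [homPullFun, h2, h3, seg_update x f p h1 (Fin.le_last _), act_comp, act_comp]
    rfl
  -- The varying morphism lies in a single block `j`, so the reindexed string changes only in its
  -- `j`-th entry and linearity of `φ` in that entry applies.
  · obtain ⟨j, hj, hj'⟩ := exists_step σ p (Fin.le_castSucc_iff.2 (not_le.1 h0))
      (Fin.castSucc_lt_iff_succ_le.1 (not_le.1 h1))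
    refine ⟨LinearMap.lcomp k _ (N.act _ _ (seg x f (Fin.le_last (σ (Fin.last m))))) ∘ₗ
      LinearMap.llcomp k _ _ _ (M.act _ _ (seg x f (Fin.zero_le (σ 0)))) ∘ₗ
        (φ (x ∘ σ)).toLinearMap (reindex x f σ) j ∘ₗ
          Linear.leftComp k _ (seg x f hj) ∘ₗ Linear.rightComp k _ (seg x f hj'), fun v => ?_⟩
    have h2 : reindex x (Function.update f p v) σ =
        Function.update (reindex x f σ) j (seg x f hj ≫ v ≫ seg x f hj') := by
      funext i
      by_cases hi : i = j
      · subst hi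
        rw [Function.update_self]
        exact seg_update x f p hj hj' v
      · rw [Function.update_of_ne hi]
        refine hre v i fun hi' => ?_
        rcases lt_or_gt_of_ne hi with hlt | hlt
        · exact hp ((hi'.2.trans (σ.monotone (Fin.succ_le_castSucc_iff.2 hlt))).trans hj)
        · exact hp ((hj'.trans (σ.monotone (Fin.succ_le_castSucc_iff.2 hlt))).trans hi'.1)
    have h3 := seg_update_of_not x f (Fin.zero_le (σ 0)) p (fun hi => h0 hi.2) v
    have h4 := seg_update_of_not x f (Fin.le_last (σ (Fin.last m))) p (fun hi => h1 hi.1) v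
    rw [homPullFun, h2, h3, h4]
    rfl

/-- The `k`-linear map on cochains with coefficients in `Hom_k(N, M)` induced by a monotone
map `σ`. -/
def homPull {m n : ℕ} (σ : Fin (m + 1) →o Fin (n + 1)) :
    HomCochain N M m →ₗ[k] HomCochain N M n where
  toFun φ x :=
    { toFun := homPullFun σ φ x
      map_update_add' := fun {inst} f p v w => by
        obtain rfl : inst = instDecidableEqFin n := Subsingleton.elim _ _
        obtain ⟨L, hL⟩ := exists_homPullFun_update σ φ x f p
        simp only [hL, map_add]
      map_update_smul' := fun {inst} f p c v => by
        obtain rfl : inst = instDecidableEqFin n := Subsingleton.elim _ _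
        obtain ⟨L, hL⟩ := exists_homPullFun_update σ φ x f p
        simp only [hL, map_smul] }
  map_add' φ ψ := by
    funext x
    ext f m
    simp [homPullFun]
  map_smul' r φ := by
    funext x
    ext f m
    simp [homPullFun]

lemma homPull_apply {m n : ℕ} (σ : Fin (m + 1) →o Fin (n + 1)) (φ : HomCochain N M m)
    (x : Fin (n + 1) → C) (f : ∀ i : Fin n, x i.castSucc ⟶ x i.succ) :
    homPull σ φ x f = M.act _ _ (seg x f (Fin.zero_le (σ 0))) ∘ₗ φ (x ∘ σ) (reindex x f σ) ∘ₗ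
      N.act _ _ (seg x f (Fin.le_last (σ (Fin.last m)))) := rfl

lemma homPull_id (n : ℕ) : homPull (N := N) (M := M) (OrderHom.id : Fin (n + 1) →o _) =
    LinearMap.id := by
  apply LinearMap.ext
  intro φ
  funext x
  apply MultilinearMap.ext
  intro f
  have h : reindex x f OrderHom.id = f := funext fun i => seg_succ x f i
  have h0 : seg x f (Fin.zero_le ((OrderHom.id : Fin (n + 1) →o _) 0)) = 𝟙 _ := seg_refl x f 0
  have h1 : seg x f (Fin.le_last ((OrderHom.id : Fin (n + 1) →o _) (Fin.last n))) = 𝟙 _ :=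
    seg_refl x f _
  rw [homPull_apply, h, h0, h1]
  erw [act_id, act_id]
  rfl

lemma homPull_comp {l m n : ℕ} (σ : Fin (l + 1) →o Fin (m + 1)) (τ : Fin (m + 1) →o Fin (n + 1)) :
    homPull (N := N) (M := M) (τ.comp σ) = homPull τ ∘ₗ homPull σ := by
  apply LinearMap.ext
  intro φ
  funext x
  apply MultilinearMap.ext
  intro f
  rw [LinearMap.comp_apply, homPull_apply, homPull_apply, homPull_apply]
  have h : reindex (x ∘ τ) (reindex x f τ) σ = reindex x f (τ.comp σ) :=
    funext fun i => seg_reindex x f τ _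
  rw [h, seg_reindex, seg_reindex]
  have h0 := seg_trans x f (Fin.zero_le (τ 0)) (τ.monotone (Fin.zero_le (σ 0)))
  have h1 := seg_trans x f (τ.monotone (Fin.le_last (σ (Fin.last l)))) (Fin.le_last _)
  have key : ∀ {a b c d e g : C} {p : a ⟶ b} {q : b ⟶ c} {pq : a ⟶ c} {s : d ⟶ e} {t : e ⟶ g}
      {st : d ⟶ g} (r : N.fiber d →ₗ[k] M.fiber c), p ≫ q = pq → s ≫ t = st →
      M.act _ _ pq ∘ₗ r ∘ₗ N.act _ _ st =
        M.act _ _ p ∘ₗ (M.act _ _ q ∘ₗ r ∘ₗ N.act _ _ s) ∘ₗ N.act _ _ t := by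
    rintro _ _ _ _ _ _ _ _ _ _ _ _ r rfl rfl
    rw [act_comp, act_comp]
    rfl
  exact key _ h0 h1

variable (N M) in
/-- The cosimplicial `k`-vector space of cochains with coefficients in `Hom_k(N, M)`. -/
def homCosimplicial : CosimplicialObject (ModuleCat.{u} k) where
  obj n := ModuleCat.of k (HomCochain N M n.len)
  map σ := ModuleCat.ofHom (homPull σ.toOrderHom)
  map_id n := by
    apply ModuleCat.hom_ext
    exact homPull_id _
  map_comp σ τ := by
    apply ModuleCat.hom_ext
    exact homPull_comp _ _

variable (N M) in
/-- The Hochschild-Mitchell complex of `C` with coefficients in `Hom_k(N, M)`. -/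
def homComplex : CochainComplex (ModuleCat.{u} k) ℕ :=
  (AlgebraicTopology.alternatingCofaceMapComplex _).obj (homCosimplicial N M)

lemma homComplex_d_apply (n : ℕ) (φ : HomCochain N M n) :
    ((homComplex N M).d n (n + 1)).hom φ =
      ∑ i : Fin (n + 2), (-1 : ℤ) ^ (i : ℕ) • homPull (Fin.succAboveOrderEmb i).toOrderHom φ := by
  have h : (homComplex N M).d n (n + 1) =
      ∑ i : Fin (n + 2), (-1 : ℤ) ^ (i : ℕ) •
        ModuleCat.ofHom (homPull (N := N) (M := M) (Fin.succAboveOrderEmb i).toOrderHom) :=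
    CochainComplex.of_d _
      (AlgebraicTopology.AlternatingCofaceMapComplex.objD (homCosimplicial N M)) n
  rw [h]
  let ev : (ModuleCat.of k (HomCochain N M n) ⟶ ModuleCat.of k (HomCochain N M (n + 1))) →+
      HomCochain N M (n + 1) :=
    { toFun := fun l => l.hom φ
      map_zero' := rfl
      map_add' := fun _ _ => rfl }
  refine (map_sum ev _ _).trans (Finset.sum_congr rfl fun i _ => ?_)
  rw [map_zsmul]
  rfl

/-- The morphism of cochains induced by a morphism of the second module. -/
def homCochainMap (N : RightMod k C) {M M' : RightMod k C} (p : M ⟶ M') (n : ℕ) :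
    HomCochain N M n →ₗ[k] HomCochain N M' n where
  toFun φ x := (LinearMap.llcomp k _ _ _ (component p (x 0))).compMultilinearMap (φ x)
  map_add' φ ψ := by
    funext x
    ext f m
    simp
  map_smul' r φ := by
    funext x
    ext f m
    simp

lemma homCochainMap_apply {M' : RightMod k C} (p : M ⟶ M') (n : ℕ) (φ : HomCochain N M n)
    (x : Fin (n + 1) → C) (f : ∀ i : Fin n, x i.castSucc ⟶ x i.succ) :
    homCochainMap N p n φ x f = component p (x 0) ∘ₗ φ x f := rfl

/-- The morphism of cosimplicial vector spaces induced by a morphism of the second module. -/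
def homCosimplicialMap (N : RightMod k C) {M M' : RightMod k C} (p : M ⟶ M') :
    homCosimplicial N M ⟶ homCosimplicial N M' where
  app n := ModuleCat.ofHom (homCochainMap N p n.len)
  naturality m n σ := by
    apply ModuleCat.hom_ext
    apply LinearMap.ext
    intro (φ : HomCochain N M m.len)
    funext x
    apply MultilinearMap.ext
    intro f
    change component p (x 0) ∘ₗ homPull σ.toOrderHom φ x f =
      homPull σ.toOrderHom (homCochainMap N p _ φ) x f
    rw [homPull_apply, homPull_apply, homCochainMap_apply, ← LinearMap.comp_assoc, component_act]
    rfl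

/-- The morphism of complexes induced by a morphism of the second module. -/
def homComplexMap (N : RightMod k C) {M M' : RightMod k C} (p : M ⟶ M') :
    homComplex N M ⟶ homComplex N M' :=
  (AlgebraicTopology.alternatingCofaceMapComplex _).map (homCosimplicialMap N p)

end HomComplex

end HochschildMitchell

/-! ### Complexes of vector spaces -/

namespace CochainComplex

variable {k : Type u} [Field k]

/-- A short complex of complexes of vector spaces is short exact if it is so in each degree. -/
lemma shortExact_of_components {S : ShortComplex (CochainComplex (ModuleCat.{u} k) ℕ)}
    (h : ∀ n, Function.Injective (S.f.f n).hom ∧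
      Function.Exact (S.f.f n).hom (S.g.f n).hom ∧ Function.Surjective (S.g.f n).hom) :
    S.ShortExact := by
  refine HomologicalComplex.shortExact_of_degreewise_shortExact _ fun n => ?_
  have : Mono (S.map (HomologicalComplex.eval _ _ n)).f :=
    (ModuleCat.mono_iff_injective _).2 (h n).1
  have : Epi (S.map (HomologicalComplex.eval _ _ n)).g :=
    (ModuleCat.epi_iff_surjective _).2 (h n).2.2
  exact { exact := (ShortComplex.ShortExact.moduleCat_exact_iff_function_exact _).2 (h n).2.1 }

lemma components_of_shortExact {S : ShortComplex (CochainComplex (ModuleCat.{u} k) ℕ)}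
    (hS : S.ShortExact) (n : ℕ) : Function.Injective (S.f.f n).hom ∧
      Function.Exact (S.f.f n).hom (S.g.f n).hom ∧ Function.Surjective (S.g.f n).hom := by
  have h := hS.map_of_exact (HomologicalComplex.eval _ _ n)
  exact ⟨(ModuleCat.mono_iff_injective _).1 h.mono_f,
    (ShortComplex.ShortExact.moduleCat_exact_iff_function_exact _).1 h.exact,
    (ModuleCat.epi_iff_surjective _).1 h.epi_g⟩

section LongExact

variable {S : ShortComplex (CochainComplex (ModuleCat.{u} k) ℕ)} (hS : S.ShortExact)

/-- The connecting map of the long exact sequence of a short exact sequence of complexes. -/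
def connecting (n : ℕ) : S.X₃.homology n →ₗ[k] S.X₁.homology (n + 1) := (hS.δ n (n + 1) rfl).hom

include hS in
lemma exact_homologyMap (n : ℕ) : Function.Exact (HomologicalComplex.homologyMap S.f n).hom
    (HomologicalComplex.homologyMap S.g n).hom :=
  (ShortComplex.ShortExact.moduleCat_exact_iff_function_exact _).1 (hS.homology_exact₂ n)

lemma exact_homologyMap_connecting (n : ℕ) :
    Function.Exact (HomologicalComplex.homologyMap S.g n).hom (connecting hS n) :=
  (ShortComplex.ShortExact.moduleCat_exact_iff_function_exact _).1
    (hS.homology_exact₃ n (n + 1) rfl)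

lemma exact_connecting_homologyMap (n : ℕ) :
    Function.Exact (connecting hS n) (HomologicalComplex.homologyMap S.f (n + 1)).hom :=
  (ShortComplex.ShortExact.moduleCat_exact_iff_function_exact _).1
    (hS.homology_exact₁ n (n + 1) rfl)

/-- The connecting map is an isomorphism if the middle complex is acyclic in two degrees. -/
def connectingEquiv (n : ℕ) (h : Subsingleton (S.X₂.homology n))
    (h' : Subsingleton (S.X₂.homology (n + 1))) :
    S.X₃.homology n ≃ₗ[k] S.X₁.homology (n + 1) :=
  LinearEquiv.ofBijective (connecting hS n) ⟨by
    rw [injective_iff_map_eq_zero]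
    intro a ha
    obtain ⟨b, rfl⟩ := (exact_homologyMap_connecting hS n a).1 ha
    rw [Subsingleton.elim b 0, map_zero], fun b =>
      (exact_connecting_homologyMap hS n b).1 (Subsingleton.elim (α := S.X₂.homology (n + 1)) _ _)⟩

end LongExact

section Zero

/-- The embedding of the cohomology in degree zero in the cochains of degree zero. -/
def homologyZeroι (K : CochainComplex (ModuleCat.{u} k) ℕ) : K.homology 0 →ₗ[k] K.X 0 :=
  (K.isoHomologyπ₀.inv ≫ K.iCycles 0).hom

variable (K : CochainComplex (ModuleCat.{u} k) ℕ)

lemma homologyZeroι_injective : Function.Injective (homologyZeroι K) :=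
  (ModuleCat.mono_iff_injective _).1 inferInstance

lemma exact_homologyZeroι : Function.Exact (homologyZeroι K) (K.d 0 1).hom := by
  intro x
  constructor
  · intro hx
    let S : ShortComplex (ModuleCat.{u} k) := ShortComplex.mk (K.iCycles 0) (K.d 0 1) (by simp)
    have hS : S.Exact := S.exact_of_f_is_kernel (K.cyclesIsKernel 0 1 (by simp))
    obtain ⟨y, hy⟩ := (ShortComplex.ShortExact.moduleCat_exact_iff_function_exact _).1 hS x |>.1 hx
    refine ⟨K.isoHomologyπ₀.hom.hom y, ?_⟩
    rw [← hy]
    exact congrArg (fun q => q.hom y) (K.isoHomologyπ₀.hom_inv_id_assoc (K.iCycles 0))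
  · rintro ⟨y, rfl⟩
    have : (K.isoHomologyπ₀.inv ≫ K.iCycles 0) ≫ K.d 0 1 = 0 := by simp
    exact congrArg (fun q => q.hom y) this

lemma homologyZeroι_naturality {K L : CochainComplex (ModuleCat.{u} k) ℕ} (f : K ⟶ L)
    (a : K.homology 0) : homologyZeroι L ((HomologicalComplex.homologyMap f 0).hom a) =
      (f.f 0).hom (homologyZeroι K a) := by
  have : HomologicalComplex.homologyMap f 0 ≫ (L.isoHomologyπ₀.inv ≫ L.iCycles 0) =
      (K.isoHomologyπ₀.inv ≫ K.iCycles 0) ≫ f.f 0 := by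
    rw [← cancel_epi K.isoHomologyπ₀.hom]
    simp
  exact congrArg (fun q => q.hom a) this

end Zero

/-- Elementwise criterion for the vanishing of the cohomology. -/
lemma subsingleton_homology_succ (K : CochainComplex (ModuleCat.{u} k) ℕ) (n : ℕ)
    (h : ∀ a : K.X (n + 1), (K.d (n + 1) (n + 2)).hom a = 0 →
      ∃ b : K.X n, (K.d n (n + 1)).hom b = a) : Subsingleton (K.homology (n + 1)) := by
  have h1 : K.ExactAt (n + 1) := by
    rw [K.exactAt_iff' n (n + 1) (n + 2) (by simp) (by simp)]
    exact (ShortComplex.moduleCat_exact_iff _).2 h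
  exact ModuleCat.subsingleton_of_isZero h1.isZero_homology

end CochainComplex

/-! ### Coinduced modules -/

namespace RightMod

open Opposite

variable {k : Type u} [Field k] {C : Type u} [SmallCategory C] [Preadditive C] [Linear k C]

/-- The right module `x ↦ ∏ y, Hom_k(C(y, x), M_y)`, coinduced from the family of vector spaces
underlying `M`. -/
def coind (M : RightMod k C) : RightMod k C where
  obj :=
    { obj x := ModuleCat.of k (∀ y : C, (y ⟶ x.unop) →ₗ[k] M.fiber y)
      map f := ModuleCat.ofHom (LinearMap.pi fun y =>
        LinearMap.lcomp k _ (Linear.rightComp k y f.unop) ∘ₗ LinearMap.proj y)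
      map_id x := by
        ext a y g
        exact congrArg (a y) (Category.comp_id g)
      map_comp f g := by
        ext a y h
        exact congrArg (a y) (Category.assoc h g.unop f.unop).symm }
  property := by
    refine ⟨fun {x y} f g => ?_, fun {x y} r f => ?_⟩
    · ext a z h
      exact (congrArg (a z) (Preadditive.comp_add _ _ _ h f g)).trans (map_add (a z) _ _)
    · ext a z h
      exact (congrArg (a z) (Linear.comp_smul _ _ _ h r f)).trans (map_smul (a z) _ _)

/-- Elements of the coinduced module at `x`, as families of linear maps. -/
def coindEquiv (M : RightMod k C) (x : C) :
    M.coind.fiber x ≃ₗ[k] (∀ y : C, (y ⟶ x) →ₗ[k] M.fiber y) := LinearEquiv.refl k _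

lemma coindEquiv_act (M : RightMod k C) {x y z : C} (f : x ⟶ y) (a : M.coind.fiber y) (g : z ⟶ x) :
    coindEquiv M x (M.coind.act x y f a) z g = coindEquiv M y a z (g ≫ f) := rfl

/-- The morphism to a coinduced module that corresponds to a family of linear maps. -/
def toCoind {N : RightMod k C} (M : RightMod k C) (a : ∀ y, N.fiber y →ₗ[k] M.fiber y) :
    N ⟶ M.coind :=
  mkHom (fun x => (coindEquiv M x).symm ∘ₗ
      LinearMap.pi fun y => (LinearMap.llcomp k _ _ _ (a y)) ∘ₗ (N.act y x).flip) fun {x y} f => by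
    ext n
    apply (coindEquiv M x).injective
    funext z
    ext g
    change a z (N.act z x g (N.act x y f n)) = a z (N.act z y (g ≫ f) n)
    rw [act_comp]
    rfl

lemma mono_of_component_injective {M N : RightMod k C} (p : M ⟶ N)
    (h : ∀ x, Function.Injective (component p x)) : Mono p := by
  refine ⟨fun a b hab => component_ext fun x => LinearMap.ext fun m => h x ?_⟩
  exact congrArg (fun q => component q x m) hab

/-- Morphisms `A ⟶ M.coind` correspond to arbitrary families of linear maps `A_y → M_y`, by
evaluation at identities. Over a field such a family extends along a monomorphism by means of linear
retractions, with no naturality to respect. -/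
instance (M : RightMod k C) : Injective M.coind where
  factors {A B} g f hf := by
    have hr : ∀ y, ∃ r : B.fiber y →ₗ[k] A.fiber y, r ∘ₗ component f y = LinearMap.id := fun y =>
      LinearMap.exists_leftInverse_of_injective _
        (LinearMap.ker_eq_bot.2 (component_injective_of_mono f y))
    choose r hr using hr
    refine ⟨toCoind M fun y => LinearMap.applyₗ (𝟙 y) ∘ₗ LinearMap.proj y ∘ₗ
      (coindEquiv M y).toLinearMap ∘ₗ component g y ∘ₗ r y, ?_⟩
    refine component_ext fun x => LinearMap.ext fun a => (coindEquiv M x).injective ?_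
    funext y
    ext h
    change coindEquiv M y (component g y (r y (B.act y x h (component f x a)))) y (𝟙 y) = _
    have h1 : B.act y x h (component f x a) = component f y (A.act y x h a) :=
      (LinearMap.congr_fun (component_act f h) a).symm
    have h2 : component g y (A.act y x h a) = M.coind.act y x h (component g x a) :=
      LinearMap.congr_fun (component_act g h) a
    have h3 : r y (component f y (A.act y x h a)) = A.act y x h a := LinearMap.congr_fun (hr y) _
    rw [h1, h3, h2, coindEquiv_act, Category.id_comp]

/-- The embedding of a module in a coinduced module. -/
def coindι (M : RightMod k C) : M ⟶ M.coind := toCoind M fun _ => LinearMap.id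

/-- Evaluation at the identity recovers the element. -/
instance (M : RightMod k C) : Mono M.coindι := by
  refine mono_of_component_injective _ fun x => ?_
  refine (injective_iff_map_eq_zero _).2 fun m hm => ?_
  have h : coindEquiv M x (component M.coindι x m) x (𝟙 x) = 0 := by
    rw [hm, map_zero]
    rfl
  change M.act x x (𝟙 x) m = 0 at h
  rwa [act_id] at h

end RightMod

/-! ### Exactness of the complexes with coefficients in `Hom_k(N, M)` -/

namespace HochschildMitchell

open RightMod

/-! ### Strings with a prepended morphism -/

section Strings

variable {C : Type u} [SmallCategory C]

/-- Prepend a morphism to a string of composable morphisms. -/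
def consString {n : ℕ} {x : Fin (n + 1) → C} {y : C} (g : y ⟶ x 0)
    (f : ∀ i : Fin n, x i.castSucc ⟶ x i.succ) :
    ∀ i : Fin (n + 1), (Fin.cons y x : Fin (n + 2) → C) i.castSucc ⟶
      (Fin.cons y x : Fin (n + 2) → C) i.succ :=
  Fin.cases g f

lemma consString_update {n : ℕ} {x : Fin (n + 1) → C} {y : C} (g : y ⟶ x 0)
    (f : ∀ i : Fin n, x i.castSucc ⟶ x i.succ) (i : Fin n) (v : x i.castSucc ⟶ x i.succ) :
    consString g (Function.update f i v) = Function.update (consString g f) i.succ v := by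
  funext j
  refine Fin.cases ?_ (fun j => ?_) j
  · exact (Function.update_of_ne (Fin.succ_ne_zero i).symm _ (consString g f)).symm
  · by_cases h : j = i
    · subst h
      exact (Function.update_self j v f).trans
        (Function.update_self (f := consString g f) j.succ _).symm
    · exact (Function.update_of_ne h v f).trans (Function.update_of_ne (f := consString g f)
        (fun h' => h (Fin.succ_injective _ h')) v).symm

lemma update_consString_zero {n : ℕ} {x : Fin (n + 1) → C} {y : C} (g g' : y ⟶ x 0)
    (f : ∀ i : Fin n, x i.castSucc ⟶ x i.succ) :
    Function.update (consString g f) 0 g' = consString g' f := by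
  funext j
  refine Fin.cases ?_ (fun j => ?_) j
  · exact Function.update_self (β := fun i : Fin (n + 1) =>
      (Fin.cons y x : Fin (n + 2) → C) i.castSucc ⟶ (Fin.cons y x : Fin (n + 2) → C) i.succ) _ _ _
  · exact Function.update_of_ne (Fin.succ_ne_zero j) _ _

/-- Values of coface maps are often known only up to propositional equality, which changes the type
of a segment; heterogeneous equality absorbs this. -/
lemma seg_heq {n : ℕ} (x : Fin (n + 1) → C) (f : ∀ i : Fin n, x i.castSucc ⟶ x i.succ)
    {a b a' b' : Fin (n + 1)} (ha : a = a') (hb : b = b') (h : a ≤ b) (h' : a' ≤ b') :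
    HEq (seg x f h) (seg x f h') := by
  subst ha hb
  rfl

lemma seg_consString_succ {n : ℕ} {x : Fin (n + 1) → C} {y : C} (g : y ⟶ x 0)
    (f : ∀ i : Fin n, x i.castSucc ⟶ x i.succ) {a b : Fin (n + 1)} (h : a ≤ b) :
    seg (Fin.cons y x) (consString g f) (Fin.succ_le_succ_iff.2 h) = seg x f h := by
  refine (seg_reindex (Fin.cons y x : Fin (n + 2) → C) (consString g f)
    (Fin.succOrderEmb (n + 1)).toOrderHom h).symm.trans ?_
  exact congrArg (fun f' => seg x f' h)
    (funext fun i => seg_succ (Fin.cons y x : Fin (n + 2) → C) (consString g f) i.succ)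

lemma seg_consString_zero {n : ℕ} {x : Fin (n + 1) → C} {y : C} (g : y ⟶ x 0)
    (f : ∀ i : Fin n, x i.castSucc ⟶ x i.succ) (b : Fin (n + 1)) :
    seg (Fin.cons y x) (consString g f) (Fin.zero_le b.succ) = g ≫ seg x f (Fin.zero_le b) := by
  refine (seg_trans (Fin.cons y x : Fin (n + 2) → C) (consString g f)
    (Fin.zero_le (Fin.succ 0)) (Fin.succ_le_succ_iff.2 (Fin.zero_le b))).symm.trans ?_
  rw [seg_consString_succ]
  exact congrArg (fun q => q ≫ seg x f (Fin.zero_le b))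
    (seg_succ (Fin.cons y x : Fin (n + 2) → C) (consString g f) 0)

end Strings

variable {k : Type u} [Field k] {C : Type u} [SmallCategory C] [Preadditive C] [Linear k C]

/-! ### Exactness in the second module -/

section Exactness

/-- The short complex of complexes deduced from a short complex of right modules. -/
def homComplexShortComplex (N : RightMod k C) (S : ShortComplex (RightMod k C)) :
    ShortComplex (CochainComplex (ModuleCat.{u} k) ℕ) :=
  ShortComplex.mk (homComplexMap N S.f) (homComplexMap N S.g) (by
    ext n (φ : HomCochain N S.X₁ n)
    funext x
    apply MultilinearMap.ext
    intro f
    have h : component S.g (x 0) ∘ₗ component S.f (x 0) = 0 := by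
      rw [← component_comp, S.zero, component_zero]
    exact (LinearMap.comp_assoc (φ x f) _ _).symm.trans
      ((congrArg (fun q => q ∘ₗ φ x f) h).trans (LinearMap.zero_comp _)))

/-- At each object the sequence of vector spaces splits, and cochains form a product of spaces of
multilinear maps in which no naturality is imposed. Composition with the splittings `r` and `s`
therefore supplies preimages. -/
lemma homComplexShortComplex_shortExact (N : RightMod k C) {S : ShortComplex (RightMod k C)}
    (hS : S.ShortExact) : (homComplexShortComplex N S).ShortExact := by
  refine CochainComplex.shortExact_of_components fun n => ?_
  have hi : ∀ x, ∃ r : S.X₂.fiber x →ₗ[k] S.X₁.fiber x, r ∘ₗ component S.f x = LinearMap.id :=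
    fun x => LinearMap.exists_leftInverse_of_injective _
      (LinearMap.ker_eq_bot.2 (shortExact_components hS x).1)
  have hs : ∀ x, ∃ s : S.X₃.fiber x →ₗ[k] S.X₂.fiber x, component S.g x ∘ₗ s = LinearMap.id :=
    fun x => LinearMap.exists_rightInverse_of_surjective _
      (LinearMap.range_eq_top.2 (shortExact_components hS x).2.2)
  choose r hr using hi
  choose s hs using hs
  change Function.Injective (homCochainMap N S.f n) ∧
    Function.Exact (homCochainMap N S.f n) (homCochainMap N S.g n) ∧
      Function.Surjective (homCochainMap N S.g n)
  refine ⟨fun φ ψ h => ?_, fun φ => ⟨fun h => ?_, ?_⟩, fun φ => ?_⟩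
  · funext x
    ext f m
    exact (shortExact_components hS (x 0)).1
      (LinearMap.congr_fun (congrArg (fun q => q f) (congrFun h x)) m)
  · refine ⟨fun x => (LinearMap.llcomp k _ _ _ (r (x 0))).compMultilinearMap (φ x), ?_⟩
    funext x
    ext f m
    have h1 : component S.g (x 0) (φ x f m) = 0 :=
      LinearMap.congr_fun (congrArg (fun q => q f) (congrFun h x)) m
    obtain ⟨a, ha⟩ := ((shortExact_components hS (x 0)).2.1 _).1 h1
    change component S.f (x 0) (r (x 0) (φ x f m)) = φ x f m
    rw [← ha]
    exact congrArg _ (LinearMap.congr_fun (hr (x 0)) a)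
  · rintro ⟨φ, rfl⟩
    funext x
    ext f m
    exact (shortExact_components hS (x 0)).2.1.apply_apply_eq_zero _
  · refine ⟨fun x => (LinearMap.llcomp k _ _ _ (s (x 0))).compMultilinearMap (φ x), ?_⟩
    funext x
    ext f m
    exact LinearMap.congr_fun (hs (x 0)) _

end Exactness

/-! ### Acyclicity for coinduced coefficients -/

section Contraction

variable {N M : RightMod k C}

/-- A cochain evaluated on a string with a variable first morphism. -/
def consEval {n : ℕ} (φ : HomCochain N M (n + 1)) (x : Fin (n + 1) → C)
    (f : ∀ i : Fin n, x i.castSucc ⟶ x i.succ) (y : C) :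
    (y ⟶ x 0) →ₗ[k] (N.fiber (x (Fin.last n)) →ₗ[k] M.fiber y) :=
  (φ (Fin.cons y x)).toLinearMap (consString 0 f) 0

lemma consEval_apply {n : ℕ} (φ : HomCochain N M (n + 1)) (x : Fin (n + 1) → C)
    (f : ∀ i : Fin n, x i.castSucc ⟶ x i.succ) (y : C) (g : y ⟶ x 0) :
    consEval φ x f y g = φ (Fin.cons y x) (consString g f) :=
  congrArg (φ (Fin.cons y x)) (update_consString_zero 0 g f)

lemma consEval_update_add {n : ℕ} (φ : HomCochain N M (n + 1)) (x : Fin (n + 1) → C)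
    (f : ∀ i : Fin n, x i.castSucc ⟶ x i.succ) (y : C) (i : Fin n)
    (v w : x i.castSucc ⟶ x i.succ) :
    consEval φ x (Function.update f i (v + w)) y =
      consEval φ x (Function.update f i v) y + consEval φ x (Function.update f i w) y := by
  apply LinearMap.ext
  intro g
  rw [LinearMap.add_apply, consEval_apply, consEval_apply, consEval_apply]
  erw [consString_update, consString_update, consString_update]
  exact (φ (Fin.cons y x)).map_update_add (consString g f) i.succ v w

lemma consEval_update_smul {n : ℕ} (φ : HomCochain N M (n + 1)) (x : Fin (n + 1) → C)
    (f : ∀ i : Fin n, x i.castSucc ⟶ x i.succ) (y : C) (i : Fin n) (r : k)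
    (v : x i.castSucc ⟶ x i.succ) :
    consEval φ x (Function.update f i (r • v)) y =
      r • consEval φ x (Function.update f i v) y := by
  apply LinearMap.ext
  intro g
  rw [LinearMap.smul_apply, consEval_apply, consEval_apply]
  erw [consString_update, consString_update]
  exact (φ (Fin.cons y x)).map_update_smul (consString g f) i.succ r v

/-- The linear map to the coinduced module at `x 0` deduced from linear maps
`C(y, x 0) ⊗ V → (coind M)_y`, by evaluation at identities. -/
def evalOne {V : Type u} [AddCommGroup V] [Module k V] (x : C) :
    (∀ y, (y ⟶ x) →ₗ[k] (V →ₗ[k] M.coind.fiber y)) →ₗ[k] (V →ₗ[k] M.coind.fiber x) where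
  toFun a := (coindEquiv M x).symm.toLinearMap ∘ₗ LinearMap.pi fun y => LinearMap.flip
    (LinearMap.llcomp k _ _ _ (LinearMap.applyₗ (𝟙 y) ∘ₗ LinearMap.proj y ∘ₗ
      (coindEquiv M y).toLinearMap) ∘ₗ a y)
  map_add' _ _ := rfl
  map_smul' _ _ := rfl

/-- The contracting homotopy of the complex with coefficients in `Hom_k(N, coind M)`. -/
def contract (n : ℕ) : HomCochain N M.coind (n + 1) →ₗ[k] HomCochain N M.coind n where
  toFun φ x :=
    { toFun := fun f => evalOne (x 0) (consEval φ x f)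
      map_update_add' := fun {inst} f i v w => by
        obtain rfl : inst = instDecidableEqFin n := Subsingleton.elim _ _
        rw [← map_add]
        exact congrArg _ (funext fun y => consEval_update_add φ x f y i v w)
      map_update_smul' := fun {inst} f i r v => by
        obtain rfl : inst = instDecidableEqFin n := Subsingleton.elim _ _
        rw [← map_smul]
        exact congrArg _ (funext fun y => consEval_update_smul φ x f y i r v) }
  map_add' _ _ := rfl
  map_smul' _ _ := rfl

lemma coindEquiv_contract {n : ℕ} (φ : HomCochain N M.coind (n + 1)) (x : Fin (n + 1) → C)
    (f : ∀ i : Fin n, x i.castSucc ⟶ x i.succ) (m : N.fiber (x (Fin.last n))) (y : C)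
    (g : y ⟶ x 0) : coindEquiv M (x 0) (contract n φ x f m) y g =
      coindEquiv M y (consEval φ x f y g m) y (𝟙 y) := rfl

/-- A form of `homPull_apply` in which the reindexed string may be replaced by one that is only
heterogeneously equal to it. -/
lemma homPull_eq {m n : ℕ} (σ : Fin (m + 1) →o Fin (n + 1)) (φ : HomCochain N M m)
    (x : Fin (n + 1) → C) (f : ∀ i : Fin n, x i.castSucc ⟶ x i.succ) {z : Fin (m + 1) → C}
    (hz : ∀ i, x (σ i) = z i) {f' : ∀ i : Fin m, z i.castSucc ⟶ z i.succ}
    (hf : ∀ i, HEq (reindex x f σ i) (f' i)) (u : x 0 ⟶ z 0)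
    (hu : HEq (seg x f (Fin.zero_le (σ 0))) u) (v : z (Fin.last m) ⟶ x (Fin.last n))
    (hv : HEq (seg x f (Fin.le_last (σ (Fin.last m)))) v) :
    homPull σ φ x f = M.act _ _ u ∘ₗ φ z f' ∘ₗ N.act _ _ v := by
  obtain rfl : x ∘ σ = z := funext hz
  obtain rfl : reindex x f σ = f' := funext fun i => eq_of_heq (hf i)
  obtain rfl := eq_of_heq hu
  obtain rfl := eq_of_heq hv
  rfl

/-- The zeroth coface lets the first morphism `g` act on the value of `φ`. In a coinduced module,
acting by `g` and evaluating at `𝟙 y` is evaluating at `g`, so the contraction undoes this coface.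
-/
lemma contract_homPull_zero {n : ℕ} (φ : HomCochain N M.coind n) :
    contract n (homPull (Fin.succAboveOrderEmb 0).toOrderHom φ) = φ := by
  funext x
  apply MultilinearMap.ext
  intro f
  apply LinearMap.ext
  intro m
  apply (coindEquiv M (x 0)).injective
  funext y
  apply LinearMap.ext
  intro g
  have hσ : ∀ i, (Fin.succAboveOrderEmb 0).toOrderHom i = Fin.succ (n := n + 1) i :=
    fun i => Fin.zero_succAbove i
  have h := homPull_eq (Fin.succAboveOrderEmb 0).toOrderHom φ (Fin.cons y x) (consString g f)
    (z := x) (fun i => by rw [hσ]; rfl) (f' := f)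
    (fun i => (seg_heq _ _ (hσ _) (hσ _) _ (Fin.succ_le_succ_iff.2 i.castSucc_lt_succ.le)).trans
      (heq_of_eq ((seg_consString_succ g f _).trans (seg_succ x f i))))
    g ((seg_heq _ _ rfl (hσ 0) _ (Fin.zero_le _)).trans
      (heq_of_eq ((seg_consString_zero g f 0).trans
        ((congrArg (fun q => g ≫ q) (seg_refl x f 0)).trans (Category.comp_id g)))))
    (𝟙 (x (Fin.last n))) ((seg_heq _ _ (hσ _) rfl _ le_rfl).trans
      (heq_of_eq (seg_refl (Fin.cons y x) (consString g f) (Fin.last (n + 1)))))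
  rw [coindEquiv_contract, consEval_apply, h]
  have h1 : N.act (x (Fin.last n)) (x (Fin.last n)) (𝟙 (x (Fin.last n))) m = m := by
    rw [act_id]
    rfl
  change coindEquiv M (x 0) (φ x f (N.act (x (Fin.last n)) (x (Fin.last n))
    (𝟙 (x (Fin.last n))) m)) y (𝟙 y ≫ g) = _
  rw [h1, Category.id_comp]

/-- With `τ` the coface of index `i + 1` and `σ` the one of index `i`, this is the remaining
identity of an extra degeneracy. If `σ 0 > 0`, the initial segment is composed with the prepended
morphism on one side and acts on the coinduced module on the other; these agree by definition of
that action. -/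
lemma contract_homPull {m n : ℕ} (σ : Fin (m + 1) →o Fin (n + 1))
    (τ : Fin (m + 2) →o Fin (n + 2)) (h0 : τ 0 = 0) (hs : ∀ i, τ (Fin.succ i) = (σ i).succ)
    (φ : HomCochain N M.coind (m + 1)) :
    contract n (homPull τ φ) = homPull σ (contract m φ) := by
  funext x
  apply MultilinearMap.ext
  intro f
  apply LinearMap.ext
  intro a
  apply (coindEquiv M (x 0)).injective
  funext y
  apply LinearMap.ext
  intro g
  have hz : ∀ i, (Fin.cons y x : Fin (n + 2) → C) (τ i) =
      (Fin.cons y (x ∘ σ) : Fin (m + 2) → C) i := by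
    refine Fin.cases ?_ fun i => ?_
    · rw [h0]
      rfl
    · rw [hs]
      rfl
  have h := homPull_eq τ φ (Fin.cons y x) (consString g f)
    (z := Fin.cons y (x ∘ σ)) hz
    (f' := consString (g ≫ seg x f (Fin.zero_le (σ 0))) (reindex x f σ))
    (Fin.cases ((seg_heq _ _ h0 (hs 0) _ (Fin.zero_le _)).trans
        (heq_of_eq (seg_consString_zero g f (σ 0)))) fun i =>
      (seg_heq _ _ (hs i.castSucc) (hs i.succ) _
        (Fin.succ_le_succ_iff.2 (σ.monotone i.castSucc_lt_succ.le))).trans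
        (heq_of_eq (seg_consString_succ g f _)))
    (𝟙 y) ((seg_heq _ _ rfl h0 _ le_rfl).trans
      (heq_of_eq (seg_refl (Fin.cons y x) (consString g f) 0)))
    (seg x f (Fin.le_last (σ (Fin.last m)))) ((seg_heq _ _ (hs (Fin.last m)) rfl _
      (Fin.succ_le_succ_iff.2 (Fin.le_last _))).trans (heq_of_eq (seg_consString_succ g f _)))
  rw [coindEquiv_contract, consEval_apply, h]
  change coindEquiv M y (φ (Fin.cons y (x ∘ σ)) (consString (g ≫ seg x f (Fin.zero_le (σ 0)))
    (reindex x f σ)) (N.act _ _ (seg x f (Fin.le_last (σ (Fin.last m)))) a)) y (𝟙 y ≫ 𝟙 y) =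
      coindEquiv M y (consEval φ (x ∘ σ) (reindex x f σ) y
      (g ≫ seg x f (Fin.zero_le (σ 0))) (N.act _ _ (seg x f (Fin.le_last (σ (Fin.last m)))) a))
        y (𝟙 y)
  rw [Category.id_comp, consEval_apply]
  rfl

/-- Applying `h` to the vanishing sum leaves `a` from the index zero and, by the shift of indices,
the opposite of the alternating sum of the `d' i`. -/
lemma alternating_sum_eq_of_contraction {A B : Type*} [AddCommGroup A] [AddCommGroup B] {n : ℕ}
    (d : Fin (n + 1) → B) (h : B →+ A) {a : A} {d' : Fin n → A} (h0 : h (d 0) = a)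
    (hs : ∀ i, h (d i.succ) = d' i) (hd : ∑ i : Fin (n + 1), (-1 : ℤ) ^ (i : ℕ) • d i = 0) :
    ∑ i : Fin n, (-1 : ℤ) ^ (i : ℕ) • d' i = a := by
  have h1 := congrArg h hd
  rw [map_sum, Fin.sum_univ_succ, map_zero] at h1
  simp only [map_neg, map_zsmul, h0, hs, Fin.val_zero, pow_zero, one_smul, Fin.val_succ, pow_succ,
    mul_neg, mul_one, neg_smul, Finset.sum_neg_distrib] at h1
  exact (sub_eq_zero.1 ((sub_eq_add_neg _ _).trans h1)).symm

lemma homComplex_coind_exact (n : ℕ) (φ : HomCochain N M.coind (n + 1))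
    (h : ((homComplex N M.coind).d (n + 1) (n + 2)).hom φ = 0) :
    ((homComplex N M.coind).d n (n + 1)).hom (contract n φ) = φ :=
  (homComplex_d_apply n (contract n φ)).trans
    (alternating_sum_eq_of_contraction
      (fun i => homPull (Fin.succAboveOrderEmb i).toOrderHom φ)
      (contract (N := N) (M := M) (n + 1)).toAddMonoidHom
      (contract_homPull_zero φ)
      (fun i => contract_homPull (Fin.succAboveOrderEmb i).toOrderHom _
        (Fin.succ_succAbove_zero i) (fun j => Fin.succ_succAbove_succ i j) φ)
      ((homComplex_d_apply (n + 1) φ).symm.trans h))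

lemma subsingleton_homology_coind (N M : RightMod k C) (n : ℕ) :
    Subsingleton ((homComplex N M.coind).homology (n + 1)) :=
  CochainComplex.subsingleton_homology_succ _ n fun φ h => ⟨_, homComplex_coind_exact n φ h⟩

end Contraction

end HochschildMitchell

/-! ### Comparison of kernels and of cokernels -/

section LinearAlgebra

variable {R : Type*} [Ring R] {A B D A' B' D' : Type*} [AddCommGroup A] [AddCommGroup B]
  [AddCommGroup D] [AddCommGroup A'] [AddCommGroup B'] [AddCommGroup D'] [Module R A] [Module R B]
  [Module R D] [Module R A'] [Module R B'] [Module R D']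

/-- Two injective linear maps that are kernels of the same map have isomorphic sources. -/
def LinearMap.equivOfKernels {i : A →ₗ[R] B} {j : A' →ₗ[R] B} {d : B →ₗ[R] D}
    (hi : Function.Injective i) (hid : Function.Exact i d) (hj : Function.Injective j)
    (hjd : Function.Exact j d) : A ≃ₗ[R] A' :=
  LinearEquiv.ofInjective i hi ≪≫ₗ
    LinearEquiv.ofEq _ _ (hid.linearMap_ker_eq.symm.trans hjd.linearMap_ker_eq) ≪≫ₗ
      (LinearEquiv.ofInjective j hj).symm

lemma LinearMap.equivOfKernels_apply {i : A →ₗ[R] B} {j : A' →ₗ[R] B} {d : B →ₗ[R] D}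
    (hi : Function.Injective i) (hid : Function.Exact i d) (hj : Function.Injective j)
    (hjd : Function.Exact j d) (a : A) : j (LinearMap.equivOfKernels hi hid hj hjd a) = i a :=
  congrArg Subtype.val ((LinearEquiv.ofInjective j hj).apply_symm_apply _)

/-- Isomorphic linear maps have isomorphic cokernels. -/
def LinearMap.equivOfCokernels {f : A →ₗ[R] B} {g : B →ₗ[R] D} {f' : A' →ₗ[R] B'}
    {g' : B' →ₗ[R] D'} (hfg : Function.Exact f g) (hg : Function.Surjective g)
    (hfg' : Function.Exact f' g') (hg' : Function.Surjective g') (a : A ≃ₗ[R] A')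
    (b : B ≃ₗ[R] B') (h : ∀ x, b (f x) = f' (a x)) : D ≃ₗ[R] D' :=
  (g.quotKerEquivOfSurjective hg).symm ≪≫ₗ
    Submodule.Quotient.equiv _ _ b (by
      rw [hfg.linearMap_ker_eq, hfg'.linearMap_ker_eq, ← LinearMap.range_comp]
      have : b.toLinearMap ∘ₗ f = f' ∘ₗ a.toLinearMap := LinearMap.ext h
      exact (congrArg LinearMap.range this).trans (LinearMap.range_comp_of_range_eq_top _ a.range))
    ≪≫ₗ g'.quotKerEquivOfSurjective hg'

end LinearAlgebra

namespace HochschildMitchell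

open RightMod

variable {k : Type u} [Field k] {C : Type u} [SmallCategory C] [Preadditive C] [Linear k C]

/-! ### Cohomology in degree zero -/

section DegreeZero

variable (N M : RightMod k C)

/-- Morphisms of right modules as cochains of degree zero. -/
def homToCochain : (N ⟶ M) →ₗ[k] (homComplex N M).X 0 where
  toFun p := show HomCochain N M 0 from fun x => MultilinearMap.constOfIsEmpty k _
    (component p (x 0))
  map_add' _ _ := rfl
  map_smul' _ _ := rfl

lemma homToCochain_apply (p : N ⟶ M) (x : Fin 1 → C)
    (f : ∀ i : Fin 0, x i.castSucc ⟶ x i.succ) :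
    (homToCochain N M p : HomCochain N M 0) x f = component p (x 0) := rfl

variable {N M} in
lemma homComplex_d_zero_apply (φ : HomCochain N M 0) (x : Fin 2 → C)
    (f : ∀ i : Fin 1, x i.castSucc ⟶ x i.succ) :
    (((homComplex N M).d 0 1).hom φ : HomCochain N M 1) x f =
      M.act (x 0) (x 1) (f 0) ∘ₗ φ (fun _ => x 1) (fun i => i.elim0) -
        φ (fun _ => x 0) (fun i => i.elim0) ∘ₗ N.act (x 0) (x 1) (f 0) := by
  have h0 : homPull (Fin.succAboveOrderEmb 0).toOrderHom φ x f = _ :=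
    homPull_eq (Fin.succAboveOrderEmb 0).toOrderHom φ x f (z := fun _ => x 1)
      (fun i => by fin_cases i; rfl) (f' := fun i => i.elim0) (fun i => i.elim0) (f 0)
      (heq_of_eq (seg_succ x f 0)) (𝟙 (x 1)) (heq_of_eq (seg_refl x f 1))
  have h1 : homPull (Fin.succAboveOrderEmb 1).toOrderHom φ x f = _ :=
    homPull_eq (Fin.succAboveOrderEmb 1).toOrderHom φ x f (z := fun _ => x 0)
      (fun i => by fin_cases i; rfl) (f' := fun i => i.elim0) (fun i => i.elim0) (𝟙 (x 0))
      (heq_of_eq (seg_refl x f 0)) (f 0) (heq_of_eq (seg_succ x f 0))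
  have e0 : N.act (x 1) (x (Fin.last (0 + 1))) (𝟙 (x 1)) = LinearMap.id := act_id N (x 1)
  rw [e0] at h0
  rw [act_id] at h1
  have h2 := homComplex_d_apply 0 φ
  rw [Fin.sum_univ_two] at h2
  refine (congrArg (fun ψ : HomCochain N M 1 => ψ x f) h2).trans ?_
  change ((-1 : ℤ) ^ 0 • homPull (Fin.succAboveOrderEmb 0).toOrderHom φ x f) +
    ((-1 : ℤ) ^ 1 • homPull (Fin.succAboveOrderEmb 1).toOrderHom φ x f) = _
  rw [h0, h1, pow_zero, one_smul, pow_one, neg_smul, one_smul, ← sub_eq_add_neg]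
  rfl

lemma homToCochain_injective : Function.Injective (homToCochain N M) := fun _ _ h =>
  component_ext fun x => congrArg (fun φ : HomCochain N M 0 => φ (fun _ => x) fun i => i.elim0) h

/-- A zero-cochain is a family of linear maps `N_x → M_x`, and its differential at `f` is the defect
of naturality at `f`. -/
lemma exact_homToCochain :
    Function.Exact (homToCochain N M) ((homComplex N M).d 0 1).hom := by
  intro (φ : HomCochain N M 0)
  constructor
  · intro h
    refine ⟨mkHom (fun x => φ (fun _ => x) fun i => i.elim0) fun {x y} f => ?_, ?_⟩
    · have h1 := homComplex_d_zero_apply φ (Fin.cons x fun _ => y)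
        (Fin.cases f fun i => i.elim0)
      rw [h] at h1
      exact (sub_eq_zero.1 h1.symm).symm
    · funext x
      apply MultilinearMap.ext
      intro f
      obtain ⟨a, rfl⟩ : ∃ a, x = fun _ => a := ⟨x 0, funext fun i =>
        congrArg x (Subsingleton.elim (α := Fin 1) i 0)⟩
      obtain rfl : f = fun i => i.elim0 := funext fun i => i.elim0
      rfl
  · rintro ⟨p, hp⟩
    subst hp
    funext x
    apply MultilinearMap.ext
    intro f
    refine (homComplex_d_zero_apply (homToCochain N M p) x f).trans ?_
    rw [homToCochain_apply, homToCochain_apply, component_act, sub_self]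
    rfl

/-- The cohomology in degree zero with coefficients in `Hom_k(N, M)` is the space of morphisms
from `N` to `M`. -/
def homologyZeroEquiv : (homComplex N M).homology 0 ≃ₗ[k] (N ⟶ M) :=
  LinearMap.equivOfKernels (CochainComplex.homologyZeroι_injective _)
    (CochainComplex.exact_homologyZeroι _) (homToCochain_injective N M) (exact_homToCochain N M)

lemma homToCochain_homologyZeroEquiv (a : (homComplex N M).homology 0) :
    homToCochain N M (homologyZeroEquiv N M a) = CochainComplex.homologyZeroι _ a :=
  LinearMap.equivOfKernels_apply _ _ _ _ a

lemma homologyZeroEquiv_naturality {M' : RightMod k C} (p : M ⟶ M')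
    (a : (homComplex N M).homology 0) : homologyZeroEquiv N M'
      ((HomologicalComplex.homologyMap (homComplexMap N p) 0).hom a) =
        homologyZeroEquiv N M a ≫ p := by
  apply homToCochain_injective
  rw [homToCochain_homologyZeroEquiv, CochainComplex.homologyZeroι_naturality,
    ← homToCochain_homologyZeroEquiv]
  rfl

end DegreeZero

/-! ### Comparison with Ext by dimension shifting -/

section Comparison

open Limits Abelian

variable (N : RightMod k C)

/-- The cosyzygy sequence of a right module. -/
def cosyzygy (M : RightMod k C) : ShortComplex (RightMod k C) :=
  ShortComplex.mk M.coindι (cokernel.π M.coindι) (cokernel.condition _)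

lemma cosyzygy_shortExact (M : RightMod k C) : (cosyzygy M).ShortExact where
  exact := ShortComplex.exact_cokernel _
  mono_f := inferInstanceAs (Mono M.coindι)
  epi_g := inferInstanceAs (Epi (cokernel.π M.coindι))

/-- The connecting map of the long exact sequence of Ext spaces. -/
def extConnecting {S : ShortComplex (RightMod k C)} (hS : S.ShortExact) (n : ℕ) :
    Ext N S.X₃ n →ₗ[k] Ext N S.X₁ (n + 1) := hS.extClass.postcompOfLinear k N rfl

lemma extConnecting_surjective {S : ShortComplex (RightMod k C)} (hS : S.ShortExact)
    [Injective S.X₂] (n : ℕ) : Function.Surjective (extConnecting N hS n) := fun x =>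
  Ext.covariant_sequence_exact₁ N hS x (Ext.eq_zero_of_injective _) rfl

/-- The degree is `n + 1` because the vanishing of `Ext N S.X₂` is needed in the source degree, and
fails in general in degree zero. -/
lemma extConnecting_injective {S : ShortComplex (RightMod k C)} (hS : S.ShortExact)
    [Injective S.X₂] (n : ℕ) : Function.Injective (extConnecting N hS (n + 1)) := by
  rw [injective_iff_map_eq_zero]
  intro x hx
  obtain ⟨y, rfl⟩ := Ext.covariant_sequence_exact₃ N hS x rfl hx
  rw [Ext.eq_zero_of_injective y, Ext.zero_comp]

/-- The beginning of the long exact sequence of Ext spaces, with spaces of morphisms in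
degree zero. -/
lemma exact_hom_extConnecting {S : ShortComplex (RightMod k C)} (hS : S.ShortExact) :
    Function.Exact (Linear.rightComp k N S.g)
      (extConnecting N hS 0 ∘ₗ (Ext.linearEquiv₀ (R := k)).symm.toLinearMap) := by
  intro p
  constructor
  · intro h
    obtain ⟨y, hy⟩ := Ext.covariant_sequence_exact₃ N hS (Ext.mk₀ p) rfl h
    obtain ⟨q, rfl⟩ := Ext.addEquiv₀.symm.surjective y
    refine ⟨q, Ext.addEquiv₀.symm.injective ?_⟩
    refine Eq.trans ?_ hy
    exact (Ext.mk₀_comp_mk₀ q S.g).symm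
  · rintro ⟨q, rfl⟩
    change (Ext.mk₀ (q ≫ S.g)).comp hS.extClass rfl = 0
    rw [← Ext.mk₀_comp_mk₀_assoc, hS.comp_extClass, Ext.comp_zero]

/-- Hochschild-Mitchell cohomology with coefficients in `Hom_k(N, M)` computes Ext spaces. -/
theorem nonempty_homology_equiv_ext (n : ℕ) : ∀ M : RightMod k C,
    Nonempty ((homComplex N M).homology (n + 1) ≃ₗ[k] Ext N M (n + 1)) := by
  induction n with
  | zero =>
    intro M
    have hS := cosyzygy_shortExact M
    have hI : Injective (cosyzygy M).X₂ := inferInstanceAs (Injective M.coind)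
    have hK := homComplexShortComplex_shortExact N hS
    -- In degree one both sides are the cokernel of the map from morphisms `N ⟶ M.coind` to
    -- morphisms from `N` to the cosyzygy.
    refine ⟨LinearMap.equivOfCokernels (CochainComplex.exact_homologyMap_connecting hK 0)
      (fun x => (CochainComplex.exact_connecting_homologyMap hK 0 x).1
        (@Subsingleton.elim _ (subsingleton_homology_coind N M 0) _ _))
      (exact_hom_extConnecting N hS)
      ((extConnecting_surjective N hS 0).comp (LinearEquiv.surjective _))
      (homologyZeroEquiv N _) (homologyZeroEquiv N _)
      (fun a => homologyZeroEquiv_naturality N _ _ a)⟩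
  | succ n ih =>
    intro M
    have hS := cosyzygy_shortExact M
    have hI : Injective (cosyzygy M).X₂ := inferInstanceAs (Injective M.coind)
    -- Both connecting maps out of degree `n + 1` of the cosyzygy are isomorphisms, so the induction
    -- hypothesis is transported by them.
    obtain ⟨e⟩ := ih (cosyzygy M).X₃
    exact ⟨(CochainComplex.connectingEquiv (homComplexShortComplex_shortExact N hS) (n + 1)
      (subsingleton_homology_coind N M n) (subsingleton_homology_coind N M (n + 1))).symm ≪≫ₗ e ≪≫ₗ
        LinearEquiv.ofBijective (extConnecting N hS (n + 1))
          ⟨extConnecting_injective N hS n, extConnecting_surjective N hS (n + 1)⟩⟩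

end Comparison

end HochschildMitchell

/-! ### Representable modules -/

namespace RightMod

open Opposite

variable {k : Type u} [Field k] {C : Type u} [SmallCategory C] [Preadditive C] [Linear k C]

variable (k) in
/-- The right module represented by an object. -/
def repr (x : C) : RightMod k C where
  obj := (linearYoneda k C).obj x
  property := by
    refine ⟨fun f g => ?_, fun r f => ?_⟩
    · ext h
      exact Preadditive.add_comp _ _ _ f g h
    · ext h
      exact Linear.smul_comp _ _ _ r f h

/-- Elements of a representable module as morphisms. -/
def reprEquiv (x y : C) : (repr k x).fiber y ≃ₗ[k] (y ⟶ x) := LinearEquiv.refl k _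

lemma act_reprEquiv_symm {x y z : C} (f : z ⟶ y) (g : y ⟶ x) :
    (repr k x).act z y f ((reprEquiv x y).symm g) = (reprEquiv x z).symm (f ≫ g) := rfl

/-- The morphism from a representable module that corresponds to an element. -/
def reprHom {x : C} (M : RightMod k C) (m : M.fiber x) : repr k x ⟶ M :=
  mkHom (fun y => (M.act y x).flip m ∘ₗ (reprEquiv x y).toLinearMap) fun {y z} f => by
    ext g
    change M.act y x (f ≫ reprEquiv x z g) m = M.act y z f (M.act z x (reprEquiv x z g) m)
    rw [act_comp]
    rfl

/-- The Yoneda lemma: naturality at `g` is applied to the identity. -/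
lemma component_repr {x : C} {M : RightMod k C} (p : repr k x ⟶ M) {y : C}
    (g : (repr k x).fiber y) :
    component p y g = M.act y x (reprEquiv x y g) (component p x ((reprEquiv x x).symm (𝟙 x))) := by
  refine Eq.trans ?_ (LinearMap.congr_fun (component_act p (reprEquiv x y g)) _)
  rw [LinearMap.comp_apply, act_reprEquiv_symm, Category.comp_id, LinearEquiv.symm_apply_apply]

/-- By Yoneda it suffices to lift the image of the identity, and epimorphisms are surjective at `x`.
-/
instance (x : C) : Projective (repr k x) where
  factors {A B} f e he := by
    obtain ⟨a, ha⟩ := component_surjective_of_epi e x (component f x ((reprEquiv x x).symm (𝟙 x)))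
    refine ⟨reprHom A a, component_ext fun y => LinearMap.ext fun g => ?_⟩
    rw [component_repr f, ← ha]
    exact LinearMap.congr_fun (component_act e _) a

end RightMod

namespace HochschildMitchell

open RightMod

variable {k : Type u} [Field k]

/-! ### Action of cochains on a module -/

section Action

variable {C : Type u} [SmallCategory C] [Preadditive C] [Linear k C] (M : RightMod k C)

/-- The action of Hochschild-Mitchell cochains on a right module. -/
def actCochain (n : ℕ) : Cochain k C n →ₗ[k] HomCochain M M n where
  toFun φ x := (M.act _ _).compMultilinearMap (φ x)
  map_add' φ ψ := by
    funext x
    ext f m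
    simp
  map_smul' r φ := by
    funext x
    ext f m
    simp

/-- The action of cochains on a right module, as a morphism of cosimplicial vector spaces. -/
def actCosimplicial : cosimplicial k C ⟶ homCosimplicial M M where
  app n := ModuleCat.ofHom (actCochain M n.len)
  naturality m n σ := by
    apply ModuleCat.hom_ext
    apply LinearMap.ext
    intro (φ : Cochain k C m.len)
    funext x
    apply MultilinearMap.ext
    intro f
    change M.act _ _ (pull σ.toOrderHom φ x f) = homPull σ.toOrderHom (actCochain M _ φ) x f
    exact (act_comp M _ _).trans (congrArg (fun q => M.act _ _
      (seg x f (Fin.zero_le (σ.toOrderHom 0))) ∘ₗ q) (act_comp M _ _))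

/-- The action of cochains on a right module, as a morphism of complexes. -/
def actComplex : complex k C ⟶ homComplex M M :=
  (AlgebraicTopology.alternatingCofaceMapComplex _).map (actCosimplicial M)

end Action

/-! ### The module represented by the new object -/

section OnePoint

variable {C : Type u} [SmallCategory C] [Preadditive C] [Linear k C] (M : RightMod k C)

/-- The module over the one-point extension represented by the new object. -/
abbrev ptMod : RightMod k (OnePointExt M) := repr k OnePointExt.pt

/-- The restriction to `C` of the module represented by the new object is `M`. -/
def ptModEquiv (x : C) : (ptMod M).fiber (OnePointExt.of x) ≃ₗ[k] M.fiber x := LinearEquiv.refl k _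

/-- Restriction to `C` of cochains of the one-point extension with coefficients in the
endomorphisms of the module represented by the new object. -/
def ptRestrictCochain (n : ℕ) : HomCochain (ptMod M) (ptMod M) n →ₗ[k] HomCochain M M n where
  toFun φ x := ((ptModEquiv M (x (Fin.last n))).arrowCongr (ptModEquiv M (x 0))).toLinearMap
    |>.compMultilinearMap ((φ ((OnePointExt.incl M).obj ∘ x)).compLinearMap fun _ =>
      (OnePointExt.incl M).mapLinearMap k)
  map_add' φ ψ := by
    funext x
    ext f m
    rfl
  map_smul' r φ := by
    funext x
    ext f m
    rfl

lemma ptRestrictCochain_apply {n : ℕ} (φ : HomCochain (ptMod M) (ptMod M) n) (x : Fin (n + 1) → C)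
    (f : ∀ i : Fin n, x i.castSucc ⟶ x i.succ) (m : M.fiber (x (Fin.last n))) :
    ptRestrictCochain M n φ x f m = ptModEquiv M (x 0) (φ ((OnePointExt.incl M).obj ∘ x)
      (fun i => (OnePointExt.incl M).map (f i)) ((ptModEquiv M (x (Fin.last n))).symm m)) := rfl

/-- Restriction to `C`, as a morphism of cosimplicial vector spaces. -/
def ptRestrictCosimplicial : homCosimplicial (ptMod M) (ptMod M) ⟶ homCosimplicial M M where
  app n := ModuleCat.ofHom (ptRestrictCochain M n.len)
  naturality m n σ := by
    apply ModuleCat.hom_ext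
    apply LinearMap.ext
    intro (φ : HomCochain (ptMod M) (ptMod M) m.len)
    funext x
    apply MultilinearMap.ext
    intro f
    apply LinearMap.ext
    intro a
    change ptRestrictCochain M _ (homPull σ.toOrderHom φ) x f a =
      homPull σ.toOrderHom (ptRestrictCochain M _ φ) x f a
    have h : (fun i => (OnePointExt.incl M).map (reindex x f σ.toOrderHom i)) =
        reindex ((OnePointExt.incl M).obj ∘ x) (fun i => (OnePointExt.incl M).map (f i))
          σ.toOrderHom := by
      funext i
      exact map_seg x f (OnePointExt.incl M) _
    rw [ptRestrictCochain_apply, homPull_apply, ← h, ← map_seg, ← map_seg]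
    rfl

/-- Restriction to `C`, as a morphism of complexes. -/
def ptRestrictComplex : homComplex (ptMod M) (ptMod M) ⟶ homComplex M M :=
  (AlgebraicTopology.alternatingCofaceMapComplex _).map (ptRestrictCosimplicial M)

/-- Restriction of cochains from the one-point extension to `C`, as a morphism of complexes. -/
def restrictComplex : complex k (OnePointExt M) ⟶ complex k C :=
  (AlgebraicTopology.alternatingCofaceMapComplex _).map
    (restrictCosimplicial (OnePointExt.inclFullyFaithful M))

/-- Because of this square the action sends the kernel of restriction to the kernel of
`ptRestrictComplex`. -/
lemma restrictComplex_comp_actComplex :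
    restrictComplex M ≫ actComplex M = actComplex (ptMod M) ≫ ptRestrictComplex M := by
  ext n (φ : Cochain k (OnePointExt M) n)
  rfl

/-- A string of objects of the one-point extension ends with the new object, or is a string of
objects of `C`, or has a step without nonzero morphisms. -/
lemma OnePointExt.string_cases {n : ℕ} (y : Fin (n + 1) → OnePointExt M) :
    y (Fin.last n) = OnePointExt.pt ∨ (∃ x : Fin (n + 1) → C, y = (OnePointExt.incl M).obj ∘ x) ∨
      ∃ j : Fin n, Subsingleton (y j.castSucc ⟶ y j.succ) := by
  by_cases hl : y (Fin.last n) = OnePointExt.pt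
  · exact Or.inl hl
  by_cases hj : ∃ j : Fin n, y j.castSucc = OnePointExt.pt ∧ y j.succ ≠ OnePointExt.pt
  · obtain ⟨j, h, h'⟩ := hj
    refine Or.inr (Or.inr ⟨j, ?_⟩)
    cases hs : y j.succ with
    | of x =>
      rw [h]
      exact inferInstanceAs (Subsingleton PUnit.{u + 1})
    | pt => exact absurd hs h'
  -- Without a step from the new object back to `C`, the new object would persist to the end of the
  -- string; as the last object is in `C`, so are all the others.
  · push Not at hj
    have h : ∀ i, y i ≠ OnePointExt.pt := by
      intro i
      induction i using Fin.reverseInduction with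
      | last => exact hl
      | cast i ih => exact fun h => ih (hj i h)
    have h' : ∀ i, ∃ x : C, y i = OnePointExt.of x := fun i => by
      cases hi : y i with
      | of x => exact ⟨x, rfl⟩
      | pt => exact absurd hi (h i)
    choose x hx using h'
    exact Or.inr (Or.inl ⟨x, funext hx⟩)

variable {M}

/-- Injectivity of the action on the kernel of restriction, by the three kinds of strings. -/
lemma eq_zero_of_act_eq_zero {n : ℕ} (φ : Cochain k (OnePointExt M) n)
    (h : restrictCochain (OnePointExt.inclFullyFaithful M) n φ = 0)
    (h' : actCochain (ptMod M) n φ = 0) : φ = 0 := by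
  funext y
  apply MultilinearMap.ext
  intro f
  rcases OnePointExt.string_cases M y with hy | ⟨x, rfl⟩ | ⟨j, hj⟩
  -- The string ends at the new object, so its action can be tested on the identity, written as
  -- `eqToHom hy`.
  · have h1 : φ y f ≫ eqToHom hy = 0 :=
      LinearMap.congr_fun (congrArg (fun ψ : HomCochain (ptMod M) (ptMod M) n => ψ y f) h')
        ((reprEquiv _ _).symm (eqToHom hy))
    exact (cancel_mono (eqToHom hy)).1 (h1.trans Limits.zero_comp.symm)
  · exact congrArg (fun ψ : Cochain k C n => ψ x f) h
  · exact (φ y).map_coord_zero j (Subsingleton.elim _ _)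

lemma OnePointExt.comp_pt {y : OnePointExt M} (u : y ⟶ OnePointExt.pt)
    (c : (OnePointExt.pt : OnePointExt M) ⟶ OnePointExt.pt) : u ≫ c = (show k from c) • u := by
  cases y <;> rfl

/-- The action maps the kernel of restriction onto the kernel of `ptRestrictCochain`. The preimage
is chosen string by string; its vanishing on strings in `C` is carried along in `key`. -/
lemma exists_act_eq {n : ℕ} (ψ : HomCochain (ptMod M) (ptMod M) n)
    (h : ptRestrictCochain M n ψ = 0) : ∃ φ : Cochain k (OnePointExt M) n,
      restrictCochain (OnePointExt.inclFullyFaithful M) n φ = 0 ∧ actCochain (ptMod M) n φ = ψ := by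
  have key : ∀ y : Fin (n + 1) → OnePointExt M, ∃ ξ : MultilinearMap k
      (fun i : Fin n => y i.castSucc ⟶ y i.succ) (y 0 ⟶ y (Fin.last n)),
      (∀ x : Fin (n + 1) → C, y = (OnePointExt.incl M).obj ∘ x → ξ = 0) ∧
        ∀ f u, ξ f ≫ u = reprEquiv _ _ (ψ y f ((reprEquiv _ _).symm u)) := by
    intro y
    rcases OnePointExt.string_cases M y with hy | ⟨x, rfl⟩ | ⟨j, hj⟩
    -- For a string ending at the new object, take the value of `ψ y f` at the identity. This
    -- determines `ψ y f`, since every `u` is a scalar multiple of the identity.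
    · refine ⟨(Linear.rightComp k _ (eqToHom hy.symm) ∘ₗ (reprEquiv _ _).toLinearMap ∘ₗ
        LinearMap.applyₗ ((reprEquiv _ _).symm (eqToHom hy))).compMultilinearMap (ψ y),
        fun x hx => ?_, fun f u => ?_⟩
      · rw [hx] at hy
        cases hy
      · have hu : u = eqToHom hy ≫ (eqToHom hy.symm ≫ u) := by simp
        change ((reprEquiv _ _ (ψ y f ((reprEquiv _ _).symm (eqToHom hy)))) ≫
          eqToHom hy.symm) ≫ u = _
        rw [Category.assoc, OnePointExt.comp_pt]
        conv_rhs => rw [hu, OnePointExt.comp_pt, map_smul, map_smul, map_smul]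
    · refine ⟨0, fun _ _ => rfl, fun f u => ?_⟩
      have h1 : ψ ((OnePointExt.incl M).obj ∘ x) f = 0 := by
        apply LinearMap.ext
        intro a
        exact LinearMap.congr_fun (congrArg (fun φ : HomCochain M M n => φ x f) h) a
      rw [h1]
      exact Limits.zero_comp
    · refine ⟨0, fun _ _ => rfl, fun f u => ?_⟩
      rw [(ψ y).map_coord_zero j (Subsingleton.elim _ _)]
      exact Limits.zero_comp
  choose φ hφ hφ' using key
  refine ⟨φ, ?_, ?_⟩
  · funext x
    apply MultilinearMap.ext
    intro f
    exact congrArg (fun ξ => ξ fun i => (OnePointExt.incl M).map (f i)) (hφ _ x rfl)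
  · funext y
    apply MultilinearMap.ext
    intro f
    apply LinearMap.ext
    intro u
    exact hφ' y f u

/-- Used to extend cochains from strings in `C` to all strings, with the default value elsewhere. No
compatibility between distinct strings is required of a cochain. -/
lemma exists_extension {ι κ : Type*} {T : κ → Type*} [∀ y, Inhabited (T y)] {g : ι → κ}
    (hg : Function.Injective g) (t : ∀ x, T (g x)) : ∃ s : ∀ y, T y, ∀ x, s (g x) = t x := by
  classical
  have key : ∀ y, ∃ s : T y, ∀ x (h : g x = y), s = h ▸ t x := by
    intro y
    by_cases hy : ∃ x, g x = y
    · obtain ⟨x, rfl⟩ := hy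
      refine ⟨t x, fun x' h => ?_⟩
      obtain rfl := hg h
      rfl
    · exact ⟨default, fun x h => absurd ⟨x, h⟩ hy⟩
  choose s hs using key
  exact ⟨s, fun x => hs _ x rfl⟩

lemma OnePointExt.incl_comp_injective (n : ℕ) :
    Function.Injective fun x : Fin (n + 1) → C => (OnePointExt.incl M).obj ∘ x := by
  intro x x' h
  funext i
  have := congrFun h i
  injection this

variable (M) in
lemma restrictCochain_surjective (n : ℕ) :
    Function.Surjective (restrictCochain (k := k) (OnePointExt.inclFullyFaithful M) n) := by
  intro φ
  obtain ⟨ψ, hψ⟩ := exists_extension (T := fun y : Fin (n + 1) → OnePointExt M =>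
    MultilinearMap k (fun i : Fin n => y i.castSucc ⟶ y i.succ) (y 0 ⟶ y (Fin.last n)))
    (OnePointExt.incl_comp_injective (M := M) n) φ
  refine ⟨ψ, ?_⟩
  funext x
  apply MultilinearMap.ext
  intro f
  exact congrArg (fun ξ => ξ fun i => (OnePointExt.incl M).map (f i)) (hψ x)

variable (M) in
lemma ptRestrictCochain_surjective (n : ℕ) : Function.Surjective (ptRestrictCochain M n) := by
  intro φ
  obtain ⟨ψ, hψ⟩ := exists_extension (T := fun y : Fin (n + 1) → OnePointExt M =>
    MultilinearMap k (fun i : Fin n => y i.castSucc ⟶ y i.succ)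
      ((ptMod M).fiber (y (Fin.last n)) →ₗ[k] (ptMod M).fiber (y 0)))
    (OnePointExt.incl_comp_injective (M := M) n) φ
  refine ⟨ψ, ?_⟩
  funext x
  apply MultilinearMap.ext
  intro f
  exact congrArg (fun ξ => ξ fun i => (OnePointExt.incl M).map (f i)) (hψ x)

end OnePoint

end HochschildMitchell

/-! ### The long exact sequence of a one-point extension -/

namespace HochschildMitchell

open RightMod Limits Abelian

variable {k : Type u} [Field k] {C : Type u} [SmallCategory C] [Preadditive C] [Linear k C]
  (M : RightMod k C)

/-- The short exact sequence of complexes given by the restriction of cochains to `C`. -/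
def restrictSequence : ShortComplex (CochainComplex (ModuleCat.{u} k) ℕ) :=
  ShortComplex.mk (kernel.ι (restrictComplex M)) (restrictComplex M) (kernel.condition _)

lemma restrictSequence_shortExact : (restrictSequence M).ShortExact where
  exact := ShortComplex.exact_kernel _
  mono_f := inferInstanceAs (Mono (kernel.ι (restrictComplex M)))
  epi_g := by
    have : ∀ n, Epi ((restrictComplex M).f n) := fun n =>
      (ModuleCat.epi_iff_surjective _).2 (restrictCochain_surjective M n)
    exact HomologicalComplex.epi_of_epi_f (restrictComplex M) this

/-- The short complex which relates the kernel of the restriction to `C` to the complex with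
coefficients in the endomorphisms of `M`. -/
def ptRestrictSequence : ShortComplex (CochainComplex (ModuleCat.{u} k) ℕ) :=
  ShortComplex.mk (kernel.ι (restrictComplex M) ≫ actComplex (ptMod M)) (ptRestrictComplex M) (by
    rw [Category.assoc, ← restrictComplex_comp_actComplex, kernel.condition_assoc, zero_comp])

/-- Injectivity and exactness in the middle are `eq_zero_of_act_eq_zero` and `exists_act_eq`, read
through the identification of the kernel complex in each degree with the kernel of restriction on
cochains. -/
lemma ptRestrictSequence_shortExact : (ptRestrictSequence M).ShortExact := by
  refine CochainComplex.shortExact_of_components fun n => ?_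
  obtain ⟨h1, h2, -⟩ := CochainComplex.components_of_shortExact (restrictSequence_shortExact M) n
  refine ⟨(injective_iff_map_eq_zero _).2 fun a ha => ?_, fun ψ => ⟨fun hψ => ?_, ?_⟩,
    ptRestrictCochain_surjective M n⟩
  · exact (injective_iff_map_eq_zero _).1 h1 a
      (eq_zero_of_act_eq_zero _ (h2.apply_apply_eq_zero a) ha)
  · obtain ⟨φ, hφ, rfl⟩ := exists_act_eq ψ hψ
    obtain ⟨a, rfl⟩ := (h2 φ).1 hφ
    exact ⟨a, rfl⟩
  · rintro ⟨a, rfl⟩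
    have h : (ptRestrictSequence M).f.f n ≫ (ptRestrictSequence M).g.f n = 0 := by
      rw [← HomologicalComplex.comp_f, (ptRestrictSequence M).zero, HomologicalComplex.zero_f]
    exact congrArg (fun q => q.hom a) h

lemma subsingleton_homology_ptMod (n : ℕ) :
    Subsingleton ((homComplex (ptMod M) (ptMod M)).homology (n + 1)) := by
  obtain ⟨e⟩ := nonempty_homology_equiv_ext (ptMod M) n (ptMod M)
  have := Ext.subsingleton_of_projective (ptMod M) (ptMod M) n
  exact e.toEquiv.subsingleton

/-- The endomorphisms of the module represented by the new object are the scalars. -/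
lemma bijective_smul_id_ptMod :
    Function.Bijective (LinearMap.toSpanSingleton k (ptMod M ⟶ ptMod M) (𝟙 (ptMod M))) := by
  constructor
  · intro c c' h
    have h1 : c * (1 : k) = c' * (1 : k) := LinearMap.congr_fun
      (congrArg (fun p : ptMod M ⟶ ptMod M => component p OnePointExt.pt) h)
      ((reprEquiv _ _).symm (𝟙 OnePointExt.pt))
    rwa [mul_one, mul_one] at h1
  · intro p
    refine ⟨(show k from reprEquiv _ _ (component p _ ((reprEquiv _ _).symm (𝟙 _)))),
      component_ext fun y => LinearMap.ext fun g => ?_⟩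
    exact (OnePointExt.comp_pt (reprEquiv _ _ g) _).symm.trans (component_repr p g).symm

/-- The cohomology in degree zero of the complex with coefficients in the endomorphisms of the
module represented by the new object is one-dimensional. -/
def homologyZeroPtMod : (homComplex (ptMod M) (ptMod M)).homology 0 ≃ₗ[k] k :=
  homologyZeroEquiv (ptMod M) (ptMod M) ≪≫ₗ
    (LinearEquiv.ofBijective _ (bijective_smul_id_ptMod M)).symm

lemma homologyZeroPtMod_smul_id (a : (homComplex (ptMod M) (ptMod M)).homology 0) :
    homologyZeroPtMod M a • 𝟙 (ptMod M) = homologyZeroEquiv (ptMod M) (ptMod M) a :=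
  (LinearEquiv.ofBijective _ (bijective_smul_id_ptMod M)).apply_symm_apply _

/-- Restriction to `C` takes a scalar endomorphism of `ptMod M` to the same scalar endomorphism of
`M`; this is where the quotient by multiples of the identity comes from. -/
lemma homologyZeroEquiv_ptRestrict (a : (homComplex (ptMod M) (ptMod M)).homology 0) :
    homologyZeroEquiv M M ((HomologicalComplex.homologyMap (ptRestrictComplex M) 0).hom a) =
      homologyZeroPtMod M a • 𝟙 M := by
  apply homToCochain_injective
  rw [homToCochain_homologyZeroEquiv, CochainComplex.homologyZeroι_naturality,
    ← homToCochain_homologyZeroEquiv, ← homologyZeroPtMod_smul_id]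
  rfl

/-- The first cohomology of the kernel of the restriction to `C`. -/
def homologyOneKernelEquiv : (kernel (restrictComplex M)).homology 1 ≃ₗ[k]
    (M ⟶ M) ⧸ Submodule.span k {𝟙 M} :=
  LinearMap.equivOfCokernels
    -- Since the first cohomology of the middle complex vanishes, the connecting map is a cokernel
    -- of `k → Hom(M, M)`.
    (CochainComplex.exact_homologyMap_connecting (ptRestrictSequence_shortExact M) 0)
    (fun x => (CochainComplex.exact_connecting_homologyMap (ptRestrictSequence_shortExact M) 0 x).1
      (@Subsingleton.elim _ (subsingleton_homology_ptMod M 0) _ _))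
    (f' := LinearMap.toSpanSingleton k (M ⟶ M) (𝟙 M)) (g' := Submodule.mkQ _)
    (LinearMap.exact_iff.2 (by rw [Submodule.ker_mkQ, LinearMap.range_toSpanSingleton]))
    (Submodule.mkQ_surjective _) (homologyZeroPtMod M) (homologyZeroEquiv M M)
    (homologyZeroEquiv_ptRestrict M)

lemma nonempty_homology_kernel_equiv_ext (n : ℕ) :
    Nonempty ((kernel (restrictComplex M)).homology (n + 2) ≃ₗ[k] Ext M M (n + 1)) := by
  obtain ⟨e⟩ := nonempty_homology_equiv_ext M n M
  exact ⟨(CochainComplex.connectingEquiv (ptRestrictSequence_shortExact M) (n + 1)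
    (subsingleton_homology_ptMod M n) (subsingleton_homology_ptMod M (n + 1))).symm ≪≫ₗ e⟩

variable {M} in
-- A class has as image in `End(ptMod M) = k` a scalar `c` with `c • 𝟙 M = 0`, so `c = 0` because
-- `M` is nonzero.
lemma subsingleton_homology_kernel_zero (hM : ¬ IsZero M) :
    Subsingleton ((kernel (restrictComplex M)).homology 0) := by
  refine subsingleton_of_forall_eq 0 fun a => ?_
  have hE := CochainComplex.exact_homologyMap (ptRestrictSequence_shortExact M) 0
  have h1 := homologyZeroEquiv_ptRestrict M
    ((HomologicalComplex.homologyMap (ptRestrictSequence M).f 0).hom a)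
  have h2 : (HomologicalComplex.homologyMap (ptRestrictComplex M) 0).hom
    ((HomologicalComplex.homologyMap (ptRestrictSequence M).f 0).hom a) = 0 :=
    hE.apply_apply_eq_zero a
  rw [h2, map_zero] at h1
  have h3 : (HomologicalComplex.homologyMap (ptRestrictSequence M).f 0).hom a = 0 :=
    (map_eq_zero_iff _ (homologyZeroPtMod M).injective).1
      ((smul_eq_zero.1 h1.symm).resolve_right fun h => hM ((IsZero.iff_id_eq_zero M).2 h))
  -- Classes of degree zero are cochains, on which the action is injective, so a zero image forces
  -- `a = 0`.
  apply CochainComplex.homologyZeroι_injective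
  apply (CochainComplex.components_of_shortExact (ptRestrictSequence_shortExact M) 0).1
  have h4 := CochainComplex.homologyZeroι_naturality (ptRestrictSequence M).f a
  rw [h3, map_zero] at h4
  rw [map_zero]
  exact h4.symm.trans (map_zero _).symm

/-- The long exact sequence of the restriction of cochains to `C`, with the cohomology of the kernel
replaced by an isomorphic space. -/
lemma exact_restrictOnePoint (n : ℕ) {A : Type*} [AddCommGroup A] [Module k A]
    (e : (kernel (restrictComplex M)).homology (n + 1) ≃ₗ[k] A) :
    Function.Exact (restrictOnePoint M n)
        (e.toLinearMap ∘ₗ CochainComplex.connecting (restrictSequence_shortExact M) n) ∧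
      Function.Exact (e.toLinearMap ∘ₗ CochainComplex.connecting (restrictSequence_shortExact M) n)
        ((HomologicalComplex.homologyMap (restrictSequence M).f (n + 1)).hom ∘ₗ
          e.symm.toLinearMap) ∧
      Function.Exact ((HomologicalComplex.homologyMap (restrictSequence M).f (n + 1)).hom ∘ₗ
          e.symm.toLinearMap) (restrictOnePoint M (n + 1)) := by
  have hS := restrictSequence_shortExact M
  refine ⟨fun x => ?_, fun x => ?_, fun x => ?_⟩
  · exact (map_eq_zero_iff _ e.injective).trans (CochainComplex.exact_homologyMap_connecting hS n x)
  · refine (CochainComplex.exact_connecting_homologyMap hS n (e.symm x)).trans ?_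
    exact exists_congr fun y =>
      ⟨fun h => (congrArg e h).trans (e.apply_symm_apply x),
        fun h => (e.symm_apply_eq.2 h.symm).symm⟩
  · refine (CochainComplex.exact_homologyMap hS (n + 1) x).trans ⟨?_, ?_⟩
    · rintro ⟨y, rfl⟩
      exact ⟨e y, congrArg _ (e.symm_apply_apply y)⟩
    · rintro ⟨y, rfl⟩
      exact ⟨e.symm y, rfl⟩

end HochschildMitchell

end

theorem mainTheorem3 {k : Type u} [Field k] {C : Type u} [SmallCategory C] [Preadditive C]
    [Linear k C] (M : RightMod k C) (hM : ¬ Limits.IsZero M) :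
    ∃ (b₀ : HochschildMitchell.HH k C 0 →ₗ[k] (M ⟶ M) ⧸ Submodule.span k {𝟙 M})
      (c₀ : ((M ⟶ M) ⧸ Submodule.span k {𝟙 M}) →ₗ[k] HochschildMitchell.HH k (OnePointExt M) 1)
      (b : ∀ n : ℕ, HochschildMitchell.HH k C (n + 1) →ₗ[k] Abelian.Ext M M (n + 1))
      (c : ∀ n : ℕ, Abelian.Ext M M (n + 1) →ₗ[k] HochschildMitchell.HH k (OnePointExt M) (n + 2)),
      Function.Injective (HochschildMitchell.restrictOnePoint M 0) ∧
      Function.Exact (HochschildMitchell.restrictOnePoint M 0) b₀ ∧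
      Function.Exact b₀ c₀ ∧
      Function.Exact c₀ (HochschildMitchell.restrictOnePoint M 1) ∧
      ∀ n : ℕ,
        Function.Exact (HochschildMitchell.restrictOnePoint M (n + 1)) (b n) ∧
        Function.Exact (b n) (c n) ∧
        Function.Exact (c n) (HochschildMitchell.restrictOnePoint M (n + 2)) := by
  have e := fun n => (HochschildMitchell.nonempty_homology_kernel_equiv_ext M n).some
  have h₀ := HochschildMitchell.exact_restrictOnePoint M 0
    (HochschildMitchell.homologyOneKernelEquiv M)
  -- The four families of maps are fixed by unification with the exactness statements: connecting
  -- maps, and maps induced by the inclusion of the kernel, transported along the chosen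
  -- isomorphisms.
  refine ⟨_, _, _, _, ?_, h₀.1, h₀.2.1, h₀.2.2,
    fun n => HochschildMitchell.exact_restrictOnePoint M (n + 1) (e n)⟩
  have h := HochschildMitchell.subsingleton_homology_kernel_zero hM
  rw [injective_iff_map_eq_zero]
  intro a ha
  obtain ⟨x, rfl⟩ := (CochainComplex.exact_homologyMap
    (HochschildMitchell.restrictSequence_shortExact M) 0 a).1 ha
  exact (congrArg _ (@Subsingleton.elim _ h x 0)).trans (map_zero _)
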